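/- Let $\mathbb T=\mathbb R\cup\{\infty\}$ and $\mathbb{TP}^{n-1}=(\mathbb T^n\setminus\{(\infty,\dots,\infty)\})/\mathbb R(1,\dots,1)$. Let $V$ be a valuated matroid of rank $d$ on $[n]=\{1,\dots,n\}$: a vector $(V_B)_{B\in\binom{[n]}d}$ with entries in $\mathbb T$, not all $\infty$, taken up to adding a real constant, such that for all $A\in\binom{[n]}{d-1}$ and $C\in\binom{[n]}{d+1}$ the minimum of $V_{A\cup\{j\}}+V_{C\setminus\{j\}}$ over $j\in C\setminus A$ is attained at more than one $j$. Assume that $V$ is connected, i.e. that its underlying matroid, whose bases are the $B$ with $V_B<\infty$, is connected. Let $$L=L(V)=\Bigl\{y\in\mathbb{TP}^{n-1}:\ \text{for every } C\in\tbinom{[n]}{d+1},\ \min_{j\in C}\,(y_j+V_{C\setminus\{j\}})\text{ is attained at more than one } j\in C\Bigr\}.$$ For $x\in\mathbb R^n$ let $V^x$ be the initial matroid, whose bases are the $B$ minimizing $V_B-\sum_{i\in B}x_i$, and let $\mathcal M(V)$ be the set of all initial matroids whose loops are loops of $V$. For $M\in\mathcal M(V)$ let $\operatorname{relint}(L_M)=\{x\in\mathbb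 R^n: V^x=M\}/\mathbb R(1,\dots,1)$; if $M$ is connected, this is a single point, denoted $v_M$. For $x\in\mathbb R^n$ and $y\in\mathbb{TP}^{n-1}$ let $\operatorname{relsupp}_x(y)$ be the set of the indices $j\in[n]$ at which $y_j-x_j$ does not attain its minimum. Write $\operatorname{cork}_M(F)=d-\operatorname{rk}_M(F)$, and call $F$ a cyclic flat of $M$ if $F$ is a flat of $M$ and $[n]\setminus F$ is a flat of the dual matroid $M^*$. For $F$ a flat of $M$ and $x\in\operatorname{relint}(L_M)$ put $$R_0(F,x,L)=\{y\in L: F\subseteq\operatorname{relsupp}_x(y)\},$$ and if $F$ is a cyclic flat of $M$ put $$R_\infty(F,x,L)=\bigcap_{y\in\operatorname{relint}(L_{M|F\oplus M/F})}R_0(F,y,L).$$ A multiset of $d$ points $A_1,\dots,A_d$ of $\mathbb{TP}^{n-1}$ is a presentation of $V$ if, for a $d\times n$ matrix $a$ whose rows are coordinate vectors of $A_1,\dots,A_d$, the vector of the tropical maximal minors $\min\{\sum_{i=1}^d a_{i,j_i}:\{j_1,\dots,j_d\}=B\}$, $B\in\binom{[n]}d$, equals $V$ up to adding a real constant. **Theorem.**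 Let $A_1,\dots,A_d\in L$. Then $\{\!\{A_1,\dots,A_d\}\!\}$ is a presentation of $V$ if and only if for every connected matroid $M\in\mathcal M(V)$ the following two conditions hold: 1. $|\{i\in[d]: A_i\in R_0(F,v_M,L)\}|\le\operatorname{cork}_M(F)$ for every flat $F$ of $M$; 2. $|\{i\in[d]: A_i\in R_\infty(F,v_M,L)\}|=\operatorname{cork}_M(F)$ for every cyclic flat $F$ of $M$. -/

import Mathlib

open Matroid

noncomputable section

/-- A tropical vector: coordinates in `𝕋 = ℝ ∪ {∞}` (here `WithTop ℝ`, with `⊕ = min`, `⊙ = +`),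
not all equal to `∞`. -/
abbrev TropVec (n : ℕ) : Type := {y : Fin n → WithTop ℝ // ∃ i, y i ≠ ⊤}

/-- Two tropical vectors are identified when they differ by a real multiple of `(1,…,1)`. -/
instance tropVecSetoid (n : ℕ) : Setoid (TropVec n) where
  r y z := ∃ c : ℝ, ∀ i, z.1 i = y.1 i + (c : WithTop ℝ)
  iseqv :=
    { refl := fun y => ⟨0, fun i => by simp⟩
      symm := by
        rintro y z ⟨c, h⟩
        refine ⟨-c, fun i => ?_⟩
        rw [h i, add_assoc, ← WithTop.coe_add]
        simp
      trans := by
        rintro x y z ⟨c, h⟩ ⟨c', h'⟩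
        refine ⟨c + c', fun i => ?_⟩
        rw [h' i, h i, add_assoc, ← WithTop.coe_add] }

/-- Tropical projective space `𝕋ℙ^{n-1}`, with homogeneous coordinates indexed by `Fin n`. -/
abbrev TropProj (n : ℕ) : Type := Quotient (tropVecSetoid n)

/-- The minimum of `f` over the finite set `s` is attained at more than one index of `s`. -/
def MinAttainedTwice {n : ℕ} (s : Finset (Fin n)) (f : Fin n → WithTop ℝ) : Prop :=
  ∃ j₁ ∈ s, ∃ j₂ ∈ s, j₁ ≠ j₂ ∧ ∀ k ∈ s, f j₁ ≤ f k ∧ f j₂ ≤ f k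

/-- A valuated matroid of rank `d` on the ground set `Fin n`, given by a vector of homogeneous
coordinates `V_B`, one for every `d`-subset `B`, not all `∞`, satisfying the tropical Plücker
relations. As a bookkeeping device the coordinate function is defined on all finite sets, with the
fixed value `∞` on those that do not have `d` elements. Two such vectors that differ by a real
constant are coordinates of the same point of tropical projective space. -/
structure ValuatedMatroid (n d : ℕ) where
  val : Finset (Fin n) → WithTop ℝ
  val_eq_top : ∀ B, B.card ≠ d → val B = ⊤
  exists_ne_top : ∃ B, val B ≠ ⊤
  plucker : ∀ A C : Finset (Fin n), A.card + 1 = d → C.card = d + 1 →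
    MinAttainedTwice (C \ A) (fun j => val (insert j A) + val (C.erase j))

/-- The tropical Stiefel map in coordinates: the tropical maximal minor of the `d × n` matrix `a`
with set of columns `B`, that is, the minimum of `∑ i, a i (j i)` over all `j : [d] → [n]`
with `{j 1, …, j d} = B`. -/
def tropicalMinor {n d : ℕ} (a : Fin d → Fin n → WithTop ℝ) (B : Finset (Fin n)) : WithTop ℝ :=
  (Finset.univ.filter (fun j : Fin d → Fin n => Finset.univ.image j = B)).inf
    (fun j => ∑ i, a i (j i))

/-- The relative support of `y` with respect to the point with finite coordinates `x`: the set of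
the indices at which `y - x` does not attain its minimum. -/
def relSupp {n : ℕ} (x : Fin n → ℝ) (p : TropProj n) : Set (Fin n) :=
  Quotient.lift
    (fun y : TropVec n =>
      {j : Fin n | ∃ k, y.1 k + ((-x k : ℝ) : WithTop ℝ) < y.1 j + ((-x j : ℝ) : WithTop ℝ)})
    (by
      rintro y z ⟨c, h⟩
      ext j
      simp only [Set.mem_ofPred_eq]
      refine exists_congr fun k => ?_
      rw [h j, h k, add_right_comm, add_right_comm (y.1 j)]
      exact (WithTop.add_lt_add_iff_right WithTop.coe_ne_top).symm) p

namespace ValuatedMatroid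

variable {n d : ℕ}

/-- The height `V_B - ∑ i ∈ B, x i`. -/
def height (V : ValuatedMatroid n d) (x : Fin n → ℝ) (B : Finset (Fin n)) : WithTop ℝ :=
  V.val B + ((-∑ i ∈ B, x i : ℝ) : WithTop ℝ)

/-- The bases of the initial matroid at `x`: the sets `B` minimizing `V_B - ∑ i ∈ B, x i`. -/
def IsInitialBase (V : ValuatedMatroid n d) (x : Fin n → ℝ) (S : Set (Fin n)) : Prop :=
  ∃ B : Finset (Fin n), (B : Set (Fin n)) = S ∧ V.val B ≠ ⊤ ∧ ∀ B', V.height x B ≤ V.height x B'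

theorem card_of_ne_top (V : ValuatedMatroid n d) {B : Finset (Fin n)} (h : V.val B ≠ ⊤) :
    B.card = d := by
  by_contra hc
  exact h (V.val_eq_top B hc)

/-- The tropical Plücker relations give a symmetric exchange. -/
theorem exists_exchange (V : ValuatedMatroid n d) {X Y : Finset (Fin n)}
    (hX : V.val X ≠ ⊤) (hY : V.val Y ≠ ⊤) {a : Fin n} (haX : a ∈ X) (haY : a ∉ Y) :
    ∃ b ∈ Y, b ∉ X ∧ V.val (insert b (X.erase a)) + V.val ((insert a Y).erase b)
      ≤ V.val X + V.val Y := by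
  have hXc := V.card_of_ne_top hX
  have hYc := V.card_of_ne_top hY
  have h1 : (X.erase a).card + 1 = d := by
    rw [Finset.card_erase_add_one haX, hXc]
  have h2 : (insert a Y).card = d + 1 := by
    rw [Finset.card_insert_of_notMem haY, hYc]
  obtain ⟨j₁, hj₁, j₂, hj₂, hne, hmin⟩ := V.plucker _ _ h1 h2
  have ha : a ∈ insert a Y \ X.erase a := by simp
  have hva : V.val (insert a (X.erase a)) + V.val ((insert a Y).erase a)
      = V.val X + V.val Y := by
    rw [Finset.insert_erase haX, Finset.erase_insert haY]
  have key : ∀ j, j ≠ a → j ∈ insert a Y \ X.erase a → j ∈ Y ∧ j ∉ X := by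
    intro j hja hj
    simp only [Finset.mem_sdiff, Finset.mem_insert, Finset.mem_erase] at hj
    tauto
  by_cases hj : j₁ = a
  · have hj2 : j₂ ≠ a := fun h => hne (hj.trans h.symm)
    exact ⟨j₂, (key j₂ hj2 hj₂).1, (key j₂ hj2 hj₂).2, hva ▸ (hmin a ha).2⟩
  · exact ⟨j₁, (key j₁ hj hj₁).1, (key j₁ hj hj₁).2, hva ▸ (hmin a ha).1⟩

theorem exists_isInitialBase (V : ValuatedMatroid n d) (x : Fin n → ℝ) :
    ∃ S, V.IsInitialBase x S := by
  obtain ⟨B, -, hB⟩ := Finset.exists_min_image (Finset.univ : Finset (Finset (Fin n)))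
    (V.height x) Finset.univ_nonempty
  refine ⟨B, B, rfl, fun h => ?_, fun B' => hB B' (Finset.mem_univ _)⟩
  obtain ⟨B₀, hB₀⟩ := V.exists_ne_top
  have := hB B₀ (Finset.mem_univ _)
  simp only [height, h, top_add, top_le_iff, WithTop.add_eq_top, WithTop.coe_ne_top,
    or_false] at this
  exact hB₀ this

theorem isInitialBase_exchange (V : ValuatedMatroid n d) (x : Fin n → ℝ) :
    Matroid.ExchangeProperty (V.IsInitialBase x) := by
  rintro _ _ ⟨X, rfl, hX, hXm⟩ ⟨Y, rfl, hY, hYm⟩ a ⟨haX, haY⟩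
  simp only [Finset.mem_coe] at haX haY
  obtain ⟨b, hbY, hbX, hle⟩ := V.exists_exchange hX hY haX haY
  have hab : b ≠ a := by rintro rfl; exact haY hbY
  have hXY : V.val X + V.val Y ≠ ⊤ := WithTop.add_ne_top.2 ⟨hX, hY⟩
  obtain ⟨h1, h2⟩ := WithTop.add_ne_top.1 (ne_top_of_le_ne_top hXY hle)
  have hsum : ∑ i ∈ insert b (X.erase a), x i + ∑ i ∈ (insert a Y).erase b, x i
      = ∑ i ∈ X, x i + ∑ i ∈ Y, x i := by
    have e1 : ∑ i ∈ insert b (X.erase a), x i = x b + ∑ i ∈ X.erase a, x i :=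
      Finset.sum_insert (by simp [hbX])
    have e2 := Finset.add_sum_erase X x haX
    have e3 := Finset.add_sum_erase (insert a Y) x (a := b) (by simp [hbY])
    have e4 : ∑ i ∈ insert a Y, x i = x a + ∑ i ∈ Y, x i := Finset.sum_insert haY
    linarith
  refine ⟨b, ⟨hbY, hbX⟩, insert b (X.erase a), by simp, h1, fun B' => (?_ : _ ≤ _).trans (hXm B')⟩
  have hY' := hYm ((insert a Y).erase b)
  simp only [height] at hY' ⊢
  obtain ⟨p, hp⟩ := WithTop.ne_top_iff_exists.1 hX
  obtain ⟨q, hq⟩ := WithTop.ne_top_iff_exists.1 hY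
  obtain ⟨r, hr⟩ := WithTop.ne_top_iff_exists.1 h1
  obtain ⟨s, hs⟩ := WithTop.ne_top_iff_exists.1 h2
  rw [← hp, ← hq, ← hr, ← hs] at hle
  rw [← hq, ← hs] at hY'
  rw [← hp, ← hr]
  norm_cast at hle hY' ⊢
  linarith

/-- The initial matroid `V^x`. -/
def initial (V : ValuatedMatroid n d) (x : Fin n → ℝ) : Matroid (Fin n) :=
  Matroid.ofIsBaseOfFinite (E := Set.univ) Set.finite_univ (V.IsInitialBase x)
    (V.exists_isInitialBase x) (V.isInitialBase_exchange x) (fun _ _ => Set.subset_univ _)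

/-- The matroid underlying `V`, whose bases are the sets `B` with `V_B` finite. -/
def underlying (V : ValuatedMatroid n d) : Matroid (Fin n) :=
  Matroid.ofIsBaseOfFinite (E := Set.univ) Set.finite_univ
    (fun S => ∃ B : Finset (Fin n), (B : Set (Fin n)) = S ∧ V.val B ≠ ⊤)
    (by
      obtain ⟨B, hB⟩ := V.exists_ne_top
      exact ⟨B, B, rfl, hB⟩)
    (by
      rintro _ _ ⟨X, rfl, hX⟩ ⟨Y, rfl, hY⟩ a ⟨haX, haY⟩
      simp only [Finset.mem_coe] at haX haY
      obtain ⟨b, hbY, hbX, hle⟩ := V.exists_exchange hX hY haX haY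
      have hXY : V.val X + V.val Y ≠ ⊤ := WithTop.add_ne_top.2 ⟨hX, hY⟩
      obtain ⟨h1, -⟩ := WithTop.add_ne_top.1 (ne_top_of_le_ne_top hXY hle)
      exact ⟨b, ⟨hbY, hbX⟩, insert b (X.erase a), by simp, h1⟩)
    (fun _ _ => Set.subset_univ _)

/-- `𝓜(V)`: the initial matroids of `V` all of whose loops are loops in `V`. -/
def initialMatroids (V : ValuatedMatroid n d) : Set (Matroid (Fin n)) :=
  {M | (∃ x, V.initial x = M) ∧ M.loops ⊆ V.underlying.loops}

/-- The tropical linear space `L(V)` in tropical projective space. -/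
def linearSpace (V : ValuatedMatroid n d) : Set (TropProj n) :=
  {p | ∀ y : TropVec n, Quotient.mk _ y = p → ∀ C : Finset (Fin n), C.card = d + 1 →
    MinAttainedTwice C (fun j => y.1 j + V.val (C.erase j))}

/-- The relative interior of the cell `L_M` (points on the faces at infinity are excluded), in
affine coordinates: the set of the `x ∈ ℝⁿ` whose initial matroid is `M`. It is invariant under
adding multiples of `(1,…,1)`. If `M` is connected, it is a single point up to such
multiples: the vertex `v_M`. -/
def relintCell (V : ValuatedMatroid n d) (M : Matroid (Fin n)) : Set (Fin n → ℝ) :=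
  {x | V.initial x = M}

/-- The region `R_0(F, x, L)`. -/
def regionZero (V : ValuatedMatroid n d) (F : Set (Fin n)) (x : Fin n → ℝ) : Set (TropProj n) :=
  {p | p ∈ V.linearSpace ∧ F ⊆ relSupp x p}

end ValuatedMatroid

/-- The matroid `M|F ⊕ M/F`. -/
def restrictSumContract {α : Type*} (M : Matroid α) (F : Set α) : Matroid α :=
  (M ↾ F).disjointSum (M ／ F) (by
    simpa using Set.disjoint_sdiff_right)

/-- A matroid is connected if it is not empty and any two distinct elements of its ground set lie in
a common circuit. -/
def MatroidConnected {α : Type*} (M : Matroid α) : Prop :=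
  M.E.Nonempty ∧ ∀ e ∈ M.E, ∀ f ∈ M.E, e ≠ f → ∃ C, M.IsCircuit C ∧ e ∈ C ∧ f ∈ C

/-- A cyclic flat: a flat of `M` whose complement is a flat of the dual. -/
def IsCyclicFlat {α : Type*} (M : Matroid α) (F : Set α) : Prop :=
  M.IsFlat F ∧ M✶.IsFlat (M.E \ F)

/-- The corank `cork_M(F) = rk(M) - rk_M(F)`. -/
def matroidCorank {α : Type*} (M : Matroid α) (F : Set α) : ℕ∞ := M.eRank - M.eRk F

namespace ValuatedMatroid

variable {n d : ℕ}

/-- The region `R_∞(F, v_M, L)`: the intersection of the regions `R_0(F, y, L)` over all `y` in the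
relative interior of the cell `L_{M|F ⊕ M/F}`. -/
def regionInfty (V : ValuatedMatroid n d) (F : Set (Fin n)) (M : Matroid (Fin n)) :
    Set (TropProj n) :=
  ⋂ y ∈ V.relintCell (restrictSumContract M F), V.regionZero F y

/-- A multiset `P` of `d` points is a presentation of `V` if, for coordinate vectors `a 1, …, a d` of
its elements, the vector of the tropical maximal minors of the matrix with rows `a 1, …, a d` and
the vector `V` are the same point of tropical projective space. -/
def IsPresentation (V : ValuatedMatroid n d) (P : Multiset (TropProj n)) : Prop :=
  ∃ a : Fin d → TropVec n,
    P = Finset.univ.val.map (fun i => (Quotient.mk _ (a i) : TropProj n)) ∧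
    ∃ c : ℝ, ∀ B : Finset (Fin n), B.card = d →
      tropicalMinor (fun i => (a i).1) B = V.val B + (c : WithTop ℝ)

end ValuatedMatroid

/-- The number of the indices `i` such that the point `A i` lies in the region `R`. -/
def countIn {n d : ℕ} (A : Fin d → TropProj n) (R : Set (TropProj n)) : ℕ∞ :=
  {i | A i ∈ R}.encard

end

/-!
Minors are computed by optimal assignments of rows to columns. If the rows `A_i` present `V`, then
exchanging along collisions between two optimal assignments shows that, at a point `x` whose initial
matroid has no coloops, an optimal assignment sends row `i` to a column outside `relsupp_x (A_i)`.
At a vertex `v_M`, a base `B` of `M|F ⊕ M/F` has exactly `cork_M(F)` elements outside `F`; rows in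
`R_0(F, v_M)` are assigned to such elements, and conversely every row assigned to one lies in
`R_∞(F, v_M)`, since moving along `F` from a point of the cell of `M|F ⊕ M/F` stays in that cell.

Conversely, at a vertex `v_M` condition 1 is Hall's condition for matching the rows to the elements
of a base outside their relative supports, so the minors of the bases of `M` agree with `V` up to a
constant. Every initial matroid is contained in a connected one, and any two adjacent bases of `V`
are bases of a common initial matroid, so the constants agree. Condition 2 at a point far out in
direction `F` forces enough rows to be `∞` on each cyclic flat `F` of the underlying matroid, and
every nonbasis violates the resulting count for the closure of one of its circuits.
-/

/-! ### Bases, flats and separators of matroids -/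

section Matroid

variable {α : Type*} {M : Matroid α} {B C F J S X : Set α} {e f g : α}

theorem isBasis_inter_of_isBasis_subset (hJ : M.IsBasis J F) (hB : M.Indep B) (hJB : J ⊆ B) :
    M.IsBasis (B ∩ F) F := by
  rwa [← hJ.eq_of_subset_indep (hB.subset Set.inter_subset_left)
    (Set.subset_inter hJB hJ.subset) Set.inter_subset_right]

theorem exists_isBase_inter_isBasis (hF : F ⊆ M.E) :
    ∃ B, M.IsBase B ∧ M.IsBasis (B ∩ F) F := by
  obtain ⟨J, hJ⟩ := M.exists_isBasis F hF
  obtain ⟨B, hB, rfl⟩ := hJ.exists_isBase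
  exact ⟨B, hB, hJ⟩

theorem exists_isBase_notMem_inter_isBasis (hF : F ⊆ M.E) (he : ¬M.IsColoop e) (heF : e ∉ F) :
    ∃ B, M.IsBase B ∧ M.IsBasis (B ∩ F) F ∧ e ∉ B := by
  obtain ⟨J, hJ⟩ := M.exists_isBasis F hF
  have hspan : M.Spanning (M.E \ {e}) := by rwa [isColoop_iff_sdiff_not_spanning, not_not] at he
  obtain ⟨B, hB, hJB, hBe⟩ := hJ.indep.exists_isBase_subset_spanning hspan
    (hJ.subset.trans (Set.subset_sdiff_singleton hF heF))
  exact ⟨B, hB, isBasis_inter_of_isBasis_subset hJ hB.indep hJB, fun h => (hBe h).2 rfl⟩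

theorem isFlat_iff_exists_isBase (hF : F ⊆ M.E) :
    M.IsFlat F ↔ ∀ e ∈ M.E \ F, ∃ B, M.IsBase B ∧ M.IsBasis (B ∩ F) F ∧ e ∈ B := by
  constructor
  · rintro h e ⟨heE, heF⟩
    obtain ⟨J, hJ⟩ := M.exists_isBasis F hF
    have heJ : e ∉ M.closure J := by rwa [hJ.closure_eq_closure, h.closure]
    obtain ⟨B, hB, hJB⟩ :=
      (hJ.indep.insert_indep_iff.2 (Or.inl ⟨heE, heJ⟩)).exists_isBase_superset
    exact ⟨B, hB, isBasis_inter_of_isBasis_subset hJ hB.indep ((Set.subset_insert _ _).trans hJB),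
      hJB (Set.mem_insert _ _)⟩
  · refine fun h => isFlat_iff_closure_eq.2
      (Set.Subset.antisymm (fun e he => ?_) (M.subset_closure F hF))
    by_contra heF
    obtain ⟨B, hB, hBF, heB⟩ := h e ⟨M.closure_subset_ground F he, heF⟩
    rw [← hBF.closure_eq_closure] at he
    have hsub : B ∩ F ⊆ B \ {e} := fun x hx => ⟨hx.1, ne_of_mem_of_not_mem hx.2 heF⟩
    exact hB.indep.notMem_closure_sdiff_of_mem heB (M.closure_subset_closure hsub he)

theorem isCyclicFlat_iff_exists_isBase (hF : F ⊆ M.E) :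
    IsCyclicFlat M F ↔
      ∀ e ∈ M.E, ∃ B, M.IsBase B ∧ M.IsBasis (B ∩ F) F ∧ (e ∈ B ↔ e ∉ F) := by
  have hdual : M✶.IsFlat (M.E \ F) ↔ ∀ e ∈ F, ∃ B, M.IsBase B ∧ M.IsBasis (B ∩ F) F ∧ e ∉ B := by
    rw [isFlat_iff_exists_isBase (by simp : M.E \ F ⊆ M✶.E)]
    simp only [dual_ground, Set.sdiff_sdiff_right_self, Set.inter_eq_self_of_subset_right hF]
    refine forall₂_congr fun e he => ⟨?_, ?_⟩
    · rintro ⟨B, hB, hBF, heB⟩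
      refine ⟨M.E \ B, hB.compl_isBase_of_dual, ?_, fun h => h.2 heB⟩
      rw [hB.compl_isBase_of_dual.inter_isBasis_iff_compl_inter_isBasis_dual hF]
      rwa [Set.sdiff_sdiff_cancel_left (show B ⊆ M.E from hB.subset_ground)]
    · rintro ⟨B, hB, hBF, heB⟩
      exact ⟨M.E \ B, hB.compl_isBase_dual,
        (hB.inter_isBasis_iff_compl_inter_isBasis_dual hF).1 hBF, hF he, heB⟩
  rw [IsCyclicFlat, isFlat_iff_exists_isBase hF, hdual]
  constructor
  · rintro ⟨h, h'⟩ e he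
    by_cases heF : e ∈ F
    · simpa [heF] using h' e heF
    · simpa [heF] using h e ⟨he, heF⟩
  · exact fun h => ⟨fun e he => by simpa [he.2] using h e he.1,
      fun e he => by simpa [he] using h e (hF he)⟩

theorem isCyclicFlat_closure (hX : X ⊆ M.E) (h : ∀ e ∈ X, e ∈ M.closure (X \ {e})) :
    IsCyclicFlat M (M.closure X) := by
  have hF := M.closure_subset_ground X
  refine (isCyclicFlat_iff_exists_isBase hF).2 fun e he => ?_
  by_cases heF : e ∈ M.closure X
  · have hcl : M.closure (X \ {e}) = M.closure X := by
      by_cases heX : e ∈ X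
      · exact closure_sdiff_singleton_eq_closure (h e heX)
      · rw [Set.sdiff_singleton_eq_self heX]
    obtain ⟨J, hJ⟩ := M.exists_isBasis (X \ {e}) (Set.sdiff_subset.trans hX)
    have hJF : M.IsBasis J (M.closure X) := hcl ▸ hJ.isBasis_closure_right
    obtain ⟨B, hB, rfl⟩ := hJF.exists_isBase
    exact ⟨B, hB, hJF, iff_of_false (fun heB => (hJ.subset ⟨heB, heF⟩).2 rfl) (not_not.2 heF)⟩
  · obtain ⟨B, hB, hBF, heB⟩ :=
      (isFlat_iff_exists_isBase hF).1 (M.isFlat_closure X) e ⟨he, heF⟩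
    exact ⟨B, hB, hBF, iff_of_true heB heF⟩

theorem matroidCorank_le_encard_sdiff (hB : M.IsBase B) (F : Set α) :
    matroidCorank M F ≤ (B \ F).encard := by
  rw [matroidCorank, tsub_le_iff_right, ← hB.encard_eq_eRank,
    ← Set.encard_sdiff_add_encard_inter B F]
  gcongr
  exact (hB.indep.subset Set.inter_subset_left).encard_le_eRk_of_subset Set.inter_subset_right

theorem matroidCorank_eq_encard_sdiff [M.RankFinite] (hB : M.IsBase B) (hBF : M.IsBasis (B ∩ F) F) :
    matroidCorank M F = (B \ F).encard := by
  have hfin : (B ∩ F).encard ≠ ⊤ := (hB.finite.subset Set.inter_subset_left).encard_lt_top.ne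
  rw [matroidCorank, ← hB.encard_eq_eRank, ← hBF.encard_eq_eRk,
    ← Set.encard_sdiff_add_encard_inter B F]
  exact (ENat.addLECancellable_of_ne_top hfin).add_tsub_cancel_right

theorem exists_isCyclicFlat_encard_sdiff_lt [M.RankFinite] (hC : C ⊆ M.E)
    (hcard : C.encard = M.eRank) (hnb : ¬M.IsBase C) :
    ∃ F, IsCyclicFlat M F ∧ (C \ F).encard < matroidCorank M F := by
  have hfin : C.encard ≠ ⊤ := hcard ▸ M.eRank_ne_top_iff.2 inferInstance
  have hdep : M.Dep C := ⟨fun hI => hnb <| hI.isBase_of_eRk_ge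
    (Set.encard_ne_top_iff.1 hfin) (by rw [hI.eRk_eq_encard, hcard]), hC⟩
  obtain ⟨D, hDC, hD⟩ := hdep.exists_isCircuit_subset
  refine ⟨M.closure D, isCyclicFlat_closure hD.subset_ground
    fun e he => hD.mem_closure_sdiff_singleton_of_mem he, ?_⟩
  have hDF : D ⊆ C ∩ M.closure D := Set.subset_inter hDC (M.subset_closure D hD.subset_ground)
  have hrank : M.eRk (M.closure D) < (C ∩ M.closure D).encard :=
    calc M.eRk (M.closure D) < M.eRk D + 1 := by
          rw [M.eRk_closure_eq]
          exact ENat.lt_add_one_iff (M.isRkFinite_set D).eRk_lt_top.ne |>.2 le_rfl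
      _ = D.encard := hD.eRk_add_one_eq
      _ ≤ _ := Set.encard_le_encard hDF
  have hdiff : (C \ M.closure D).encard ≠ ⊤ :=
    ne_top_of_le_ne_top hfin (Set.encard_le_encard Set.sdiff_subset)
  rw [matroidCorank, lt_tsub_iff_right, ← hcard,
    ← Set.encard_sdiff_add_encard_inter C (M.closure D)]
  exact (ENat.add_lt_add_iff_left hdiff).2 hrank

theorem contract_isBase_iff_of_isBasis (hJ : M.IsBasis J F) (hXF : Disjoint F X) :
    (M ／ F).IsBase X ↔ M.IsBase (X ∪ J) := by
  have hindep : (M ／ F).Indep X ↔ M.Indep (X ∪ J) := hJ.contract_indep_iff_of_disjoint hXF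
  have hspan : (M ／ F).Spanning X ↔ M.Spanning (X ∪ J) := by
    have hFE := hJ.subset_ground
    have hJE := hJ.indep.subset_ground
    rw [contract_spanning_iff hFE, and_iff_left hXF.symm]
    simp only [spanning_iff, closure_union_congr_right hJ.closure_eq_closure,
      Set.union_subset_iff, hFE, hJE]
  exact ⟨fun h => (hindep.1 h.indep).isBase_of_spanning (hspan.1 h.spanning),
    fun h => (hindep.2 h.indep).isBase_of_spanning (hspan.2 h.spanning)⟩

theorem restrictSumContract_ground (hF : F ⊆ M.E) : (restrictSumContract M F).E = M.E := by
  simp [restrictSumContract, Set.union_eq_self_of_subset_left hF]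

theorem restrictSumContract_isBase_iff (hF : F ⊆ M.E) :
    (restrictSumContract M F).IsBase B ↔ M.IsBase B ∧ M.IsBasis (B ∩ F) F := by
  have hsdiff (hB : B ⊆ M.E) : B ∩ (M.E \ F) = B \ F := by
    rw [← Set.inter_sdiff_assoc, Set.inter_eq_self_of_subset_left hB]
  rw [restrictSumContract, disjointSum_isBase_iff, restrict_ground_eq, contract_ground,
    isBase_restrict_iff hF, Set.union_sdiff_cancel hF]
  constructor
  · rintro ⟨hBF, hB, hBE⟩
    rw [hsdiff hBE, contract_isBase_iff_of_isBasis hBF Set.disjoint_sdiff_right,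
      Set.sdiff_union_inter] at hB
    exact ⟨hB, hBF⟩
  · rintro ⟨hB, hBF⟩
    refine ⟨hBF, ?_, hB.subset_ground⟩
    rwa [hsdiff hB.subset_ground, contract_isBase_iff_of_isBasis hBF Set.disjoint_sdiff_right,
      Set.sdiff_union_inter]

theorem restrictSumContract_restrictSumContract (hF : F ⊆ M.E) :
    restrictSumContract (restrictSumContract M F) F = restrictSumContract M F := by
  have hF' : F ⊆ (restrictSumContract M F).E := hF.trans_eq (restrictSumContract_ground hF).symm
  refine ext_isBase (restrictSumContract_ground hF') fun B _ => ?_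
  rw [restrictSumContract_isBase_iff hF', and_iff_left_iff_imp]
  intro hB
  have hBF := ((restrictSumContract_isBase_iff hF).1 hB).2
  refine (hB.indep.subset Set.inter_subset_left).isBasis_of_maximal_subset Set.inter_subset_right
    fun J hJ hBJ hJF => ?_
  obtain ⟨B', hB', hJB'⟩ := hJ.exists_isBase_superset
  have hJM : M.Indep J := ((restrictSumContract_isBase_iff hF).1 hB').1.indep.subset hJB'
  exact (hBF.eq_of_subset_indep hJM hBJ hJF).superset

theorem exists_isCircuit_mem_trans [M.Finitary] {C₁ C₂ : Set α}
    (h₁ : M.IsCircuit C₁) (h₂ : M.IsCircuit C₂) (he : e ∈ C₁) (hg : g ∈ C₂)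
    (hne : (C₁ ∩ C₂).Nonempty) : ∃ C, M.IsCircuit C ∧ e ∈ C ∧ g ∈ C := by
  by_contra hcon
  push Not at hcon
  induction hN : (C₁ ∪ C₂).ncard using Nat.strong_induction_on generalizing C₁ C₂ with
  | _ N ih =>
  subst hN
  have hU : (C₁ ∪ C₂).Finite := h₁.finite.union h₂.finite
  obtain ⟨f, hf₁, hf₂⟩ := hne
  obtain ⟨C₃, hs₃, h₃, he₃⟩ := h₁.strong_elimination h₂ hf₁ hf₂ he (fun h => hcon _ h₂ h hg)
  obtain ⟨C₄, hs₄, h₄, hg₄⟩ := h₂.strong_elimination h₁ hf₂ hf₁ hg (fun h => hcon _ h₁ he h)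
  rw [Set.union_comm] at hs₄
  have hf₃ : f ∉ C₃ := fun h => (hs₃ h).2 rfl
  have hf₄ : f ∉ C₄ := fun h => (hs₄ h).2 rfl
  obtain ⟨a, ha₃, ha₁⟩ := Set.not_subset.1
    fun h : C₃ ⊆ C₁ => hf₃ ((h₃.eq_of_subset_isCircuit h₁ h).symm ▸ hf₁)
  obtain ⟨b, hb₄, hb₂⟩ := Set.not_subset.1
    fun h : C₄ ⊆ C₂ => hf₄ ((h₄.eq_of_subset_isCircuit h₂ h).symm ▸ hf₂)
  have ha₂ : a ∈ C₂ := (hs₃ ha₃).1.resolve_left ha₁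
  have hb₁ : b ∈ C₁ := (hs₄ hb₄).1.resolve_right hb₂
  have hunion : C₃ ∪ C₂ = C₁ ∪ C₂ := by
    by_contra hne
    have hsub : C₃ ∪ C₂ ⊆ C₁ ∪ C₂ :=
      Set.union_subset (hs₃.trans Set.sdiff_subset) Set.subset_union_right
    exact ih _ (Set.ncard_lt_ncard (hsub.ssubset_of_ne hne) hU) h₃ h₂ he₃ hg ⟨a, ha₃, ha₂⟩ rfl
  have hb₃ : b ∈ C₃ := (hunion.symm.subset (Or.inl hb₁)).resolve_right hb₂
  have hssub : C₃ ∪ C₄ ⊂ C₁ ∪ C₂ :=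
    ⟨Set.union_subset (hs₃.trans Set.sdiff_subset) (hs₄.trans Set.sdiff_subset),
      fun h => (h (Or.inl hf₁)).elim hf₃ hf₄⟩
  exact ih _ (Set.ncard_lt_ncard hssub hU) h₃ h₄ he₃ hg₄ ⟨b, hb₃, hb₄⟩ rfl

theorem isBase_induction_exchange [M.RankFinite] {β : Type*} (φ : Set α → β)
    (h : ∀ B a b, M.IsBase B → a ∈ B → b ∉ B → M.IsBase (insert b (B \ {a})) →
      φ B = φ (insert b (B \ {a}))) {B B' : Set α} (hB : M.IsBase B) (hB' : M.IsBase B') :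
    φ B = φ B' := by
  induction hN : (B \ B').ncard using Nat.strong_induction_on generalizing B with
  | _ N ih =>
  subst hN
  by_cases hsub : B ⊆ B'
  · rw [hB.eq_of_subset_isBase hB' hsub]
  obtain ⟨a, ha, ha'⟩ := Set.not_subset.1 hsub
  obtain ⟨b, hb, hBb⟩ := hB.exchange hB' ⟨ha, ha'⟩
  rw [h B a b hB ha hb.2 hBb]
  have hsdiff : insert b (B \ {a}) \ B' = (B \ B') \ {a} := by
    rw [Set.insert_sdiff_of_mem _ hb.1, Set.sdiff_sdiff_comm]
  refine ih _ ?_ hBb rfl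
  rw [hsdiff]
  exact Set.ncard_sdiff_singleton_lt_of_mem ⟨ha, ha'⟩ (hB.finite.subset Set.sdiff_subset)

theorem exists_isBase_exchange_of_isCircuit (hC : M.IsCircuit C) (he : e ∈ C) (hf : f ∈ C)
    (hef : e ≠ f) : ∃ B, M.IsBase B ∧ f ∈ B ∧ e ∉ B ∧ M.IsBase (insert e (B \ {f})) := by
  obtain ⟨B, hB, hCB⟩ := (hC.sdiff_singleton_indep he).exists_isBase_superset
  have hCeB : C ⊆ insert e B := Set.sdiff_singleton_subset_iff.1 hCB
  have heB : e ∉ B := fun h => hC.not_indep (hB.indep.subset (Set.insert_eq_of_mem h ▸ hCeB))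
  have hfund : f ∈ M.fundCircuit e B := hC.eq_fundCircuit_of_subset hB.indep hCeB ▸ hf
  rw [hB.indep.mem_fundCircuit_iff (hB.closure_eq.symm ▸ hC.subset_ground he) heB,
    ← Set.insert_sdiff_singleton_comm hef] at hfund
  exact ⟨B, hB, hCB ⟨hf, hef.symm⟩, heB, hB.exchange_isBase_of_indep heB hfund⟩

/-- A separator of `M`, for matroids of finite rank: a set that every base meets in the same number
of elements. -/
def IsSeparator (M : Matroid α) (S : Set α) : Prop :=
  ∀ B B', M.IsBase B → M.IsBase B' → (B ∩ S).ncard = (B' ∩ S).ncard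

theorem isSeparator_iff_forall_isCircuit [M.RankFinite] :
    IsSeparator M S ↔ ∀ C, M.IsCircuit C → ∀ e ∈ C, ∀ f ∈ C, e ∈ S → f ∈ S := by
  constructor
  · intro h C hC e he f hf heS
    by_contra hfS
    obtain ⟨B, hB, -, heB, hB'⟩ :=
      exists_isBase_exchange_of_isCircuit hC he hf (fun hef => hfS (hef ▸ heS))
    have hcard := h _ _ hB hB'
    rw [Set.insert_inter_of_mem heS, Set.sdiff_inter_right_comm,
      Set.sdiff_singleton_eq_self fun h => hfS h.2, Set.ncard_insert_of_notMem (fun h => heB h.1)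
      (hB.finite.subset Set.inter_subset_left)] at hcard
    omega
  · intro h B B' hB hB'
    refine isBase_induction_exchange (fun B => (B ∩ S).ncard) (fun B a b hB ha hb hBb => ?_) hB hB'
    have hbE : b ∈ M.E := hBb.subset_ground (Set.mem_insert _ _)
    have hba : b ≠ a := fun h => hb (h ▸ ha)
    have hC := hB.fundCircuit_isCircuit hbE hb
    have haC : a ∈ M.fundCircuit b B := by
      rw [hB.indep.mem_fundCircuit_iff (hB.closure_eq.symm ▸ hbE) hb,
        ← Set.insert_sdiff_singleton_comm hba]
      exact hBb.indep
    have hbC := M.mem_fundCircuit b B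
    by_cases haS : a ∈ S
    · simp only [Set.insert_inter_of_mem (h _ hC a haC b hbC haS), Set.sdiff_inter_right_comm]
      exact (Set.ncard_exchange (fun h : b ∈ B ∩ S => hb h.1) (Set.mem_inter ha haS)).symm
    · simp only [Set.insert_inter_of_notMem fun hbS => haS (h _ hC b hbC a haC hbS),
        Set.sdiff_inter_right_comm, Set.sdiff_singleton_eq_self fun h : a ∈ B ∩ S => haS h.2]

theorem matroidConnected_iff_forall_isSeparator [M.RankFinite] :
    MatroidConnected M ↔
      M.E.Nonempty ∧ ∀ S, IsSeparator M S → ∀ e ∈ M.E, ∀ f ∈ M.E, e ∈ S → f ∈ S := by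
  refine and_congr_right fun _ => ⟨fun h S hS e he f hf heS => ?_, fun h e he f hf hef => ?_⟩
  · by_cases hef : e = f
    · exact hef ▸ heS
    · obtain ⟨C, hC, heC, hfC⟩ := h e he f hf hef
      exact isSeparator_iff_forall_isCircuit.1 hS C hC e heC f hfC heS
  · set S : Set α := {g | g = e ∨ ∃ C, M.IsCircuit C ∧ e ∈ C ∧ g ∈ C}
    suffices hsep : IsSeparator M S from
      (h S hsep e he f hf (Or.inl rfl)).resolve_left hef.symm
    refine isSeparator_iff_forall_isCircuit.2 ?_
    rintro C hC a ha b hb (rfl | ⟨C', hC', heC', haC'⟩)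
    · exact Or.inr ⟨C, hC, ha, hb⟩
    · exact Or.inr (exists_isCircuit_mem_trans hC' hC heC' hb ⟨a, haC', ha⟩)

end Matroid

/-! ### Minimizers of functions perturbed by linear forms -/

section ArgMin

variable {β : Type*} {s s' : Finset β} {h u : β → ℝ} {b : β} {t : ℝ}

open Classical in
/-- The set of the minimizers of `h` on `s`. -/
noncomputable def argMin (s : Finset β) (h : β → ℝ) : Finset β :=
  s.filter fun b => ∀ b' ∈ s, h b ≤ h b'

theorem mem_argMin : b ∈ argMin s h ↔ b ∈ s ∧ ∀ b' ∈ s, h b ≤ h b' := by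
  simp [argMin]

theorem argMin_subset : argMin s h ⊆ s := fun _ hb => (mem_argMin.1 hb).1

theorem argMin_nonempty (hs : s.Nonempty) (h : β → ℝ) : (argMin s h).Nonempty := by
  obtain ⟨b, hb, hmin⟩ := s.exists_min_image h hs
  exact ⟨b, mem_argMin.2 ⟨hb, hmin⟩⟩

theorem argMin_smul (ht : 0 < t) : argMin s (t • h) = argMin s h := by
  ext b
  simp only [mem_argMin, Pi.smul_apply, smul_eq_mul, mul_le_mul_iff_right₀ ht]

theorem argMin_eq_of_subset (hs' : s' ⊆ s) (hsub : argMin s h ⊆ s') :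
    argMin s h = argMin s' h := by
  ext b
  refine ⟨fun hb => mem_argMin.2 ⟨hsub hb, fun b' hb' => (mem_argMin.1 hb).2 b' (hs' hb')⟩,
    fun hb => mem_argMin.2 ⟨hs' (argMin_subset hb), fun b' hb' => ?_⟩⟩
  obtain ⟨b₀, hb₀⟩ := argMin_nonempty ⟨b', hb'⟩ h
  exact ((mem_argMin.1 hb).2 b₀ (hsub hb₀)).trans ((mem_argMin.1 hb₀).2 b' hb')

theorem argMin_add_smul_of_subset (ht : 0 < t) (hsub : argMin s (h + t • u) ⊆ argMin s h) :
    argMin s (h + t • u) = argMin (argMin s h) u := by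
  have hconst : ∀ b ∈ argMin s h, ∀ b' ∈ argMin s h, h b = h b' := fun b hb b' hb' =>
    ((mem_argMin.1 hb).2 b' (argMin_subset hb')).antisymm
      ((mem_argMin.1 hb').2 b (argMin_subset hb))
  rw [argMin_eq_of_subset argMin_subset hsub]
  ext b
  refine mem_argMin.trans (Iff.trans ?_ mem_argMin.symm)
  refine and_congr_right fun hb => forall₂_congr fun b' hb' => ?_
  simp only [Pi.add_apply, Pi.smul_apply, smul_eq_mul, hconst b hb b' hb', add_le_add_iff_left,
    mul_le_mul_iff_right₀ ht]

theorem argMin_add_smul_of_mem (ht : 0 < t) (hb : b ∈ argMin s h) (hb' : b ∈ argMin s u) :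
    argMin s (h + t • u) = argMin (argMin s h) u := by
  refine argMin_add_smul_of_subset ht fun c hc => mem_argMin.2 ⟨argMin_subset hc, fun c' hc' => ?_⟩
  have hcb : h c + t * u c ≤ h b + t * u b := (mem_argMin.1 hc).2 b (argMin_subset hb)
  have hu : t * u b ≤ t * u c :=
    mul_le_mul_of_nonneg_left ((mem_argMin.1 hb').2 c (argMin_subset hc)) ht.le
  linarith [(mem_argMin.1 hb).2 c' hc']

theorem exists_pos_argMin_add_smul (s : Finset β) (h u : β → ℝ) :
    ∃ ε : ℝ, 0 < ε ∧ argMin s (h + ε • u) = argMin (argMin s h) u := by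
  have hev : ∀ᶠ ε : ℝ in nhdsWithin 0 (Set.Ioi 0), ∀ b ∈ s, ∀ b' ∈ s, h b < h b' →
      (h + ε • u) b < (h + ε • u) b' := by
    simp only [Filter.eventually_all_finset, Filter.eventually_imp_distrib_left]
    refine fun b _ b' _ hlt => Filter.Eventually.filter_mono nhdsWithin_le_nhds ?_
    exact ContinuousAt.eventually_lt (by simp only [Pi.add_apply, Pi.smul_apply]; fun_prop)
      (by simp only [Pi.add_apply, Pi.smul_apply]; fun_prop) (by simpa using hlt)
  obtain ⟨ε, hε, hpos⟩ := (hev.and self_mem_nhdsWithin).exists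
  refine ⟨ε, hpos, argMin_add_smul_of_subset hpos fun b hb =>
    mem_argMin.2 ⟨argMin_subset hb, fun b' hb' => le_of_not_gt fun hlt => ?_⟩⟩
  exact (hε b' hb' b (argMin_subset hb) hlt).not_ge ((mem_argMin.1 hb).2 b' hb')

theorem exists_pos_argMin_smul_add (s : Finset β) (h u : β → ℝ) :
    ∃ t : ℝ, 0 < t ∧ argMin s (h + t • u) = argMin (argMin s u) h := by
  obtain ⟨ε, hε, heq⟩ := exists_pos_argMin_add_smul s u h
  refine ⟨ε⁻¹, inv_pos.2 hε, ?_⟩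
  rw [← heq, ← argMin_smul (inv_pos.2 hε) (h := u + ε • h), smul_add, inv_smul_smul₀ hε.ne',
    add_comm]

theorem exists_argMin_ssubset_of_lt {a : ℝ} (hs : s.Nonempty) (hu : ∀ b ∈ argMin s h, u b = a)
    (hb : ∃ b ∈ s, u b < a) : ∃ t : ℝ, argMin s h ⊂ argMin s (h + t • u) := by
  obtain ⟨b₀, hb₀⟩ := argMin_nonempty hs h
  obtain ⟨hb₀s, hmin⟩ := mem_argMin.1 hb₀
  have hne : (s.filter fun b => u b < a).Nonempty := Finset.filter_nonempty_iff.2 hb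
  obtain ⟨b₁, hb₁, hb₁min⟩ := Finset.exists_min_image _ (fun b => (h b - h b₀) / (a - u b)) hne
  obtain ⟨hb₁s, hb₁a⟩ := Finset.mem_filter.1 hb₁
  set t := (h b₁ - h b₀) / (a - u b₁)
  have ht0 : 0 ≤ t := div_nonneg (by linarith [hmin b₁ hb₁s]) (by linarith)
  have ht1 : t * (a - u b₁) = h b₁ - h b₀ := div_mul_cancel₀ _ (by linarith)
  have hlower : ∀ b ∈ s, h b₀ + t * a ≤ h b + t * u b := fun b hbs => by
    by_cases hba : u b < a
    · have hle := hb₁min b (Finset.mem_filter.2 ⟨hbs, hba⟩)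
      rw [le_div_iff₀ (by linarith)] at hle
      linarith
    · nlinarith [hmin b hbs]
  refine ⟨t, fun b hb => mem_argMin.2 ⟨argMin_subset hb, fun b' hb' => ?_⟩, fun hsub => ?_⟩
  · have hle := (mem_argMin.1 hb).2 b₀ hb₀s
    simpa [hu b hb] using (add_le_add_left hle (t * a)).trans (hlower b' hb')
  · have hb₁' : b₁ ∈ argMin s (h + t • u) := mem_argMin.2 ⟨hb₁s, fun b' hb' => by
      have := hlower b' hb'
      simp only [Pi.add_apply, Pi.smul_apply, smul_eq_mul]
      linarith⟩
    exact hb₁a.ne (hu b₁ (hsub hb₁'))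

theorem exists_argMin_ssubset {a : ℝ} (hs : s.Nonempty) (hu : ∀ b ∈ argMin s h, u b = a)
    (hb : ∃ b ∈ s, u b ≠ a) : ∃ t : ℝ, argMin s h ⊂ argMin s (h + t • u) := by
  obtain ⟨b, hbs, hba⟩ := hb
  rcases hba.lt_or_gt with hlt | hgt
  · exact exists_argMin_ssubset_of_lt hs hu ⟨b, hbs, hlt⟩
  · obtain ⟨t, ht⟩ := exists_argMin_ssubset_of_lt (u := -u) hs
      (fun b hb => congrArg Neg.neg (hu b hb)) ⟨b, hbs, neg_lt_neg hgt⟩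
    exact ⟨-t, by rwa [neg_smul, ← smul_neg]⟩

end ArgMin

section InitialSets

variable {α : Type*} {𝓑 : Finset (Finset α)} {ω : Finset α → ℝ} {x g : α → ℝ} {B C : Finset α}
  {t : ℝ}

/-- The members of `𝓑` that minimize `ω B - ∑ i ∈ B, x i`. If `𝓑` is the set of the bases of a
valuated matroid `ω`, these are the bases of its initial matroid at `x`. -/
noncomputable def initialSets (𝓑 : Finset (Finset α)) (ω : Finset α → ℝ) (x : α → ℝ) :
    Finset (Finset α) :=
  argMin 𝓑 fun B => ω B - ∑ i ∈ B, x i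

/-- The face of `𝓑` in direction `g`: the members of `𝓑` that maximize `∑ i ∈ B, g i`. -/
noncomputable def baseFace (𝓑 : Finset (Finset α)) (g : α → ℝ) : Finset (Finset α) :=
  argMin 𝓑 fun B => -∑ i ∈ B, g i

theorem mem_initialSets : B ∈ initialSets 𝓑 ω x ↔
    B ∈ 𝓑 ∧ ∀ B' ∈ 𝓑, ω B - ∑ i ∈ B, x i ≤ ω B' - ∑ i ∈ B', x i := mem_argMin

theorem initialSets_subset : initialSets 𝓑 ω x ⊆ 𝓑 := argMin_subset

theorem initialSets_nonempty (h𝓑 : 𝓑.Nonempty) (ω : Finset α → ℝ) (x : α → ℝ) :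
    (initialSets 𝓑 ω x).Nonempty := argMin_nonempty h𝓑 _

theorem mem_baseFace : B ∈ baseFace 𝓑 g ↔ B ∈ 𝓑 ∧ ∀ B' ∈ 𝓑, ∑ i ∈ B', g i ≤ ∑ i ∈ B, g i := by
  simp only [baseFace, mem_argMin, neg_le_neg_iff]

theorem baseFace_subset : baseFace 𝓑 g ⊆ 𝓑 := argMin_subset

theorem mem_baseFace_of_subset {𝓒 : Finset (Finset α)} (h : 𝓒 ⊆ 𝓑) (hB : B ∈ 𝓒)
    (hBg : B ∈ baseFace 𝓑 g) : B ∈ baseFace 𝓒 g :=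
  mem_baseFace.2 ⟨hB, fun B' hB' => (mem_baseFace.1 hBg).2 B' (h hB')⟩

theorem baseFace_nonempty (h𝓑 : 𝓑.Nonempty) (g : α → ℝ) : (baseFace 𝓑 g).Nonempty :=
  argMin_nonempty h𝓑 _

theorem initialSets_add_smul : initialSets 𝓑 ω (x + t • g) =
    argMin 𝓑 ((fun B => ω B - ∑ i ∈ B, x i) + t • fun B => -∑ i ∈ B, g i) := by
  refine congrArg (argMin 𝓑) (funext fun B => ?_)
  simp only [Pi.add_apply, Pi.smul_apply, smul_eq_mul, Finset.sum_add_distrib, ← Finset.mul_sum]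
  ring

theorem initialSets_add_smul_of_mem (ht : 0 < t) (hB : B ∈ initialSets 𝓑 ω x)
    (hBg : B ∈ baseFace 𝓑 g) :
    initialSets 𝓑 ω (x + t • g) = baseFace (initialSets 𝓑 ω x) g :=
  initialSets_add_smul.trans (argMin_add_smul_of_mem ht hB hBg)

theorem exists_pos_initialSets_add_smul (𝓑 : Finset (Finset α)) (ω : Finset α → ℝ)
    (x g : α → ℝ) : ∃ ε : ℝ,
      0 < ε ∧ initialSets 𝓑 ω (x + ε • g) = baseFace (initialSets 𝓑 ω x) g := by
  simp only [initialSets_add_smul]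
  exact exists_pos_argMin_add_smul _ _ _

theorem exists_initialSets_add_smul_eq (𝓑 : Finset (Finset α)) (ω : Finset α → ℝ)
    (x g : α → ℝ) : ∃ t : ℝ, initialSets 𝓑 ω (x + t • g) = initialSets (baseFace 𝓑 g) ω x := by
  simp only [initialSets_add_smul]
  obtain ⟨t, -, ht⟩ := exists_pos_argMin_smul_add 𝓑 (fun B => ω B - ∑ i ∈ B, x i)
    fun B => -∑ i ∈ B, g i
  exact ⟨t, ht⟩

theorem exists_initialSets_superset (h𝓑 : 𝓑.Nonempty) (ω : Finset α → ℝ) (x : α → ℝ) :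
    ∃ v, initialSets 𝓑 ω x ⊆ initialSets 𝓑 ω v ∧
      ∀ (u : α → ℝ) (a : ℝ), (∀ B ∈ initialSets 𝓑 ω v, ∑ i ∈ B, u i = a) →
        ∀ B ∈ 𝓑, ∑ i ∈ B, u i = a := by
  have hfin : (Set.range (initialSets 𝓑 ω)).Finite :=
    𝓑.powerset.finite_toSet.subset
      (Set.range_subset_iff.2 fun _ => Finset.mem_coe.2 (Finset.mem_powerset.2 initialSets_subset))
  obtain ⟨_, hxv, ⟨v, rfl⟩, hmax⟩ := hfin.exists_le_maximal (Set.mem_range_self x)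
  refine ⟨v, hxv, fun u a hu B hB => of_not_not fun hBa => ?_⟩
  obtain ⟨t, ht⟩ := exists_argMin_ssubset (u := fun B => -∑ i ∈ B, u i) h𝓑
    (fun B hB => congrArg Neg.neg (hu B hB)) ⟨B, hB, fun h => hBa (neg_injective h)⟩
  rw [← initialSets_add_smul] at ht
  exact ht.2 (hmax (Set.mem_range_self _) ht.1)

theorem exists_mem_iff_of_sum_eq_imp {𝓒 : Finset (Finset α)}
    (h : ∀ (u : α → ℝ) (a : ℝ), (∀ B ∈ 𝓒, ∑ i ∈ B, u i = a) → ∀ B ∈ 𝓑, ∑ i ∈ B, u i = a)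
    (hB : B ∈ 𝓑) (e : α) : ∃ B' ∈ 𝓒, (e ∈ B' ↔ e ∈ B) := by
  classical
  by_contra! hcon
  have hsum : ∀ B' : Finset α, ∑ i ∈ B', (Pi.single e 1 : α → ℝ) i = if e ∈ B' then 1 else 0 :=
    fun B' => by rw [Finset.sum_pi_single']
  have hBa := h (Pi.single e 1) (if e ∈ B then 0 else 1) (fun B' hB' => by
    rw [hsum]
    rcases hcon B' hB' with ⟨h₁, h₂⟩ | ⟨h₁, h₂⟩ <;> simp [h₁, h₂]) B hB
  rw [hsum] at hBa
  split_ifs at hBa <;> norm_num at hBa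

theorem mem_baseFace_interval [DecidableEq α] {I U : Finset α} (hB : B ∈ 𝓑) (hIB : I ⊆ B)
    (hBU : B ⊆ U) :
    C ∈ baseFace 𝓑 (fun i => (if i ∈ I then 1 else 0) - if i ∈ U then 0 else 1) ↔
      C ∈ 𝓑 ∧ I ⊆ C ∧ C ⊆ U := by
  have hsum : ∀ D : Finset α, ∑ i ∈ D, ((if i ∈ I then 1 else 0) - if i ∈ U then 0 else 1 : ℝ) =
      (D ∩ I).card - (D \ U).card := fun D => by
    rw [Finset.sum_sub_distrib]
    simp [Finset.sum_ite, Finset.filter_mem_eq_inter, Finset.filter_notMem_eq_sdiff]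
  have hle : ∀ D : Finset α, (D ∩ I).card ≤ I.card := fun D =>
    Finset.card_le_card Finset.inter_subset_right
  have hBsum : ((B ∩ I).card : ℝ) - (B \ U).card = I.card := by
    rw [Finset.inter_eq_right.2 hIB, Finset.sdiff_eq_empty_iff_subset.2 hBU]
    simp
  simp only [mem_baseFace, hsum]
  refine and_congr_right fun _ => ⟨fun hmax => ?_, fun ⟨hIC, hCU⟩ D _ => ?_⟩
  · have hCB := hmax B hB
    rw [hBsum, le_sub_iff_add_le] at hCB
    norm_cast at hCB
    have hCI := hle C
    exact ⟨Finset.inter_eq_right.1 (Finset.eq_of_subset_of_card_le Finset.inter_subset_right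
      (by omega)), Finset.sdiff_eq_empty_iff_subset.1 (Finset.card_eq_zero.1 (by omega))⟩
  · rw [Finset.inter_eq_right.2 hIC, Finset.sdiff_eq_empty_iff_subset.2 hCU]
    have hDI : ((D ∩ I).card : ℝ) ≤ I.card := by exact_mod_cast hle D
    have hDU : (0 : ℝ) ≤ (D \ U).card := Nat.cast_nonneg _
    simpa only [Finset.card_empty, Nat.cast_zero] using sub_le_sub hDI hDU

end InitialSets

/-! ### Optimal assignments -/

section Assignment

variable {ι κ R : Type*}

theorem injective_update_of_notMem_range [DecidableEq ι] {σ : ι → κ} (hσ : Function.Injective σ)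
    {e : κ} (he : e ∉ Set.range σ) (i : ι) : Function.Injective (Function.update σ i e) := by
  have hne : ∀ k, σ k ≠ e := fun k hk => he ⟨k, hk⟩
  intro k m hkm
  by_cases hk : k = i <;> by_cases hm : m = i
  · rw [hk, hm]
  · exact absurd (by simpa [hk, hm] using hkm.symm) (hne m)
  · exact absurd (by simpa [hk, hm] using hkm) (hne k)
  · exact hσ (by simpa [hk, hm] using hkm)

theorem image_update_univ [Fintype ι] [DecidableEq ι] [DecidableEq κ] {σ : ι → κ}
    (hσ : Function.Injective σ) {e : κ} (he : e ∉ Set.range σ) (i : ι) :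
    Finset.univ.image (Function.update σ i e) = (insert e (Finset.univ.image σ)).erase (σ i) := by
  have hei : e ≠ σ i := fun h => he ⟨i, h.symm⟩
  have hrest : (Finset.univ.erase i).image (Function.update σ i e) =
      (Finset.univ.erase i).image σ :=
    Finset.image_congr fun k hk => Function.update_of_ne (Finset.ne_of_mem_erase hk) _ _
  rw [← Finset.insert_erase (Finset.mem_univ i), Finset.image_insert, hrest, Function.update_self,
    Finset.insert_erase (Finset.mem_univ i), Finset.image_erase hσ,
    Finset.erase_insert_of_ne hei]

theorem add_sum_update [Fintype ι] [DecidableEq ι] [AddCommMonoid R] (c : ι → κ → R) (σ : ι → κ)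
    (i : ι) (j : κ) :
    c i (σ i) + ∑ k, c k (Function.update σ i j k) = c i j + ∑ k, c k (σ k) := by
  have hrest : ∑ k ∈ Finset.univ.erase i, c k (Function.update σ i j k) =
      ∑ k ∈ Finset.univ.erase i, c k (σ k) := Finset.sum_congr rfl fun k hk => by
    rw [Function.update_of_ne (Finset.ne_of_mem_erase hk)]
  rw [← Finset.add_sum_erase _ (fun k => c k (Function.update σ i j k)) (Finset.mem_univ i),
    ← Finset.add_sum_erase _ (fun k => c k (σ k)) (Finset.mem_univ i), hrest,
    Function.update_self, add_left_comm]

theorem exists_injective_swap {f τ : ι → κ} {i : ι} (hf : Set.InjOn f {i}ᶜ)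
    (hτ : Function.Injective τ) (hi : f i ∉ Set.range τ) :
    ∃ Q : Set ι, ∀ [DecidablePred (· ∈ Q)],
      Function.Injective (Q.piecewise f τ) ∧ Function.Injective (Q.piecewise τ f) := by
  -- Start at the indices `i₀ ≠ i` that collide with `i` and follow the collisions of `τ` with `f`.
  let Q : Set ι := {k | ∃ i₀ ≠ i, f i₀ = f i ∧
    Relation.ReflTransGen (fun k m => τ k = f m) i₀ k}
  have hiQ : i ∉ Q := by
    rintro ⟨i₀, hi₀, -, hpath⟩
    rcases hpath.cases_tail with h | ⟨k, -, hk⟩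
    · exact hi₀ h.symm
    · exact hi ⟨k, hk⟩
  have hforward : ∀ {k m}, τ k = f m → k ∈ Q → m ∈ Q := fun hkm ⟨i₀, hne, heq, hpath⟩ =>
    ⟨i₀, hne, heq, hpath.tail hkm⟩
  have hbackward : ∀ {k m}, τ k = f m → m ∈ Q → k ∈ Q := by
    rintro k m hkm ⟨i₀, hne, heq, hpath⟩
    rcases hpath.cases_tail with rfl | ⟨k', hpath', hk'⟩
    · exact absurd ⟨k, hkm.trans heq⟩ hi
    · exact ⟨i₀, hne, heq, hτ (hkm.trans hk'.symm) ▸ hpath'⟩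
  have hfQ : Set.InjOn f Q := hf.mono fun k hk (hki : k = i) => hiQ (hki ▸ hk)
  have hfQc : Set.InjOn f Qᶜ := by
    have hcollide : ∀ k ∉ Q, f k = f i → k = i := fun k hk hki =>
      of_not_not fun hne => hk ⟨k, hne, hki, .refl⟩
    intro k hk m hm hkm
    by_cases hki : k = i
    · rw [hki] at hkm ⊢
      exact (hcollide m hm hkm.symm).symm
    by_cases hmi : m = i
    · rw [hmi] at hkm ⊢
      exact hcollide k hk hkm
    exact hf hki hmi hkm
  refine ⟨Q, fun {_} => ⟨?_, ?_⟩⟩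
  · exact (Set.injective_piecewise_iff Q).2
      ⟨hfQ, hτ.injOn, fun k hk m hm h => hm (hbackward h.symm hk)⟩
  · exact (Set.injective_piecewise_iff Q).2
      ⟨hτ.injOn, hfQc, fun k hk m hm h => hm (hforward h hk)⟩

/-- `σ` assigns distinct columns to the rows of `c`, at the smallest possible total cost. -/
def IsOptimalAssignment [Fintype ι] [AddCommMonoid R] [LE R] (c : ι → κ → R) (σ : ι → κ) : Prop :=
  Function.Injective σ ∧ ∀ ρ : ι → κ, Function.Injective ρ → ∑ i, c i (σ i) ≤ ∑ i, c i (ρ i)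

theorem IsOptimalAssignment.le_of_notMem_range [Fintype ι] [AddCommMonoid R] [PartialOrder R]
    [IsOrderedAddMonoid R] {c : ι → κ → R} {σ τ : ι → κ} (hσ : IsOptimalAssignment c σ)
    (hτ : IsOptimalAssignment c τ) (hcancel : AddLECancellable (∑ i, c i (σ i))) {j : κ}
    (hj : j ∉ Set.range τ) (i : ι) : c i (σ i) ≤ c i j := by
  classical
  set f := Function.update σ i j with hf
  have hf_inj : Set.InjOn f {i}ᶜ := fun k hk m hm hkm => hσ.1 <| by
    rwa [hf, Function.update_of_ne hk, Function.update_of_ne hm] at hkm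
  obtain ⟨Q, hQ⟩ := exists_injective_swap hf_inj hτ.1 (by rwa [hf, Function.update_self])
  have hswap : ∑ k, c k (Q.piecewise f τ k) + ∑ k, c k (Q.piecewise τ f k) =
      ∑ k, c k (f k) + ∑ k, c k (τ k) := by
    rw [← Finset.sum_add_distrib, ← Finset.sum_add_distrib]
    refine Finset.sum_congr rfl fun k _ => ?_
    by_cases hk : k ∈ Q
    · simp only [Set.piecewise_eq_of_mem _ _ _ hk]
    · simp only [Set.piecewise_eq_of_notMem _ _ _ hk, add_comm]
  have hστ : ∑ k, c k (σ k) = ∑ k, c k (τ k) := (hσ.2 τ hτ.1).antisymm (hτ.2 σ hσ.1)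
  have hle : ∑ k, c k (σ k) ≤ ∑ k, c k (f k) := by
    rw [← hστ] at hswap
    exact hcancel.add_le_add_iff_right.1
      ((add_le_add (hσ.2 _ hQ.1) (hσ.2 _ hQ.2)).trans_eq hswap)
  refine hcancel.add_le_add_iff_right.1 ?_
  calc c i (σ i) + ∑ k, c k (σ k) ≤ c i (σ i) + ∑ k, c k (f k) := add_le_add_right hle _
    _ = c i j + ∑ k, c k (σ k) := add_sum_update c σ i j

end Assignment

theorem sum_indicator_one {α : Type*} (F : Set α) (B : Finset α) :
    ∑ i ∈ B, F.indicator (1 : α → ℝ) i = (((B : Set α) ∩ F).ncard : ℝ) := by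
  classical
  have hcoe : (B : Set α) ∩ F = ((B.filter (· ∈ F) : Finset α) : Set α) := by ext; simp
  simp only [hcoe, Set.ncard_coe_finset, Finset.card_filter, Nat.cast_sum, Set.indicator_apply,
    Pi.one_apply, Nat.cast_ite, Nat.cast_one, Nat.cast_zero]

section BaseFinsets

variable {α : Type*} [Fintype α] {M N : Matroid α} {B : Finset α} {F : Set α}

open Classical in
/-- The bases of a matroid on a finite type, as finite sets. -/
noncomputable def baseFinsets (M : Matroid α) : Finset (Finset α) :=
  Finset.univ.filter fun B => M.IsBase B

theorem mem_baseFinsets : B ∈ baseFinsets M ↔ M.IsBase B := by simp [baseFinsets]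

theorem exists_mem_baseFinsets_coe_eq {S : Set α} (hS : M.IsBase S) :
    ∃ B ∈ baseFinsets M, (B : Set α) = S := by
  obtain ⟨B, rfl⟩ := S.toFinite.exists_finset_coe
  exact ⟨B, mem_baseFinsets.2 hS, rfl⟩

theorem baseFinsets_nonempty (M : Matroid α) : (baseFinsets M).Nonempty := by
  obtain ⟨S, hS⟩ := M.exists_isBase
  obtain ⟨B, hB, -⟩ := exists_mem_baseFinsets_coe_eq hS
  exact ⟨B, hB⟩

theorem eq_of_baseFinsets_eq (hE : M.E = N.E) (h : baseFinsets M = baseFinsets N) : M = N := by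
  refine ext_isBase hE fun S _ => ?_
  obtain ⟨B, rfl⟩ := S.toFinite.exists_finset_coe
  rw [← mem_baseFinsets, h, mem_baseFinsets]

theorem mem_baseFace_indicator_iff (hF : F ⊆ M.E) :
    B ∈ baseFace (baseFinsets M) (F.indicator 1) ↔ M.IsBase B ∧ M.IsBasis (B ∩ F) F := by
  simp only [mem_baseFace, sum_indicator_one, Nat.cast_le, mem_baseFinsets]
  refine and_congr_right fun hB => ⟨fun hmax => ?_, fun hBF B' hB' => ?_⟩
  · obtain ⟨S, hS, hSF⟩ := exists_isBase_inter_isBasis hF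
    obtain ⟨B', -, rfl⟩ := exists_mem_baseFinsets_coe_eq hS
    have hind := hB.indep.subset (Set.inter_subset_left (t := F))
    refine hind.isBasis_of_eRk_ge (Set.toFinite _) Set.inter_subset_right ?_ hF
    rw [hind.eRk_eq_encard, ← hSF.encard_eq_eRk, ← (Set.toFinite _).cast_ncard_eq,
      ← (Set.toFinite _).cast_ncard_eq]
    exact_mod_cast hmax B' hS
  · have hle := (hB'.indep.subset (Set.inter_subset_left (t := F))).encard_le_eRk_of_subset
      Set.inter_subset_right
    rw [← hBF.encard_eq_eRk, ← (Set.toFinite _).cast_ncard_eq,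
      ← (Set.toFinite _).cast_ncard_eq] at hle
    exact_mod_cast hle

theorem baseFinsets_restrictSumContract (hF : F ⊆ M.E) :
    baseFinsets (restrictSumContract M F) = baseFace (baseFinsets M) (F.indicator 1) := by
  ext B
  rw [mem_baseFinsets, restrictSumContract_isBase_iff hF, mem_baseFace_indicator_iff hF]

end BaseFinsets

section TropicalVectors

variable {n d : ℕ} {y : TropVec n} {x : Fin n → ℝ} {j : Fin n}

theorem minAttainedTwice_iff {s : Finset (Fin n)} {f : Fin n → WithTop ℝ} :
    MinAttainedTwice s f ↔ s.Nonempty ∧ ∀ e ∈ s, ∃ j ∈ s, j ≠ e ∧ f j ≤ f e := by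
  constructor
  · rintro ⟨j₁, hj₁, j₂, hj₂, hne, hmin⟩
    refine ⟨⟨j₁, hj₁⟩, fun e he => ?_⟩
    by_cases h : j₁ = e
    · exact ⟨j₂, hj₂, fun h' => hne (h.trans h'.symm), (hmin e he).2⟩
    · exact ⟨j₁, hj₁, h, (hmin e he).1⟩
  · rintro ⟨hs, h⟩
    obtain ⟨j₁, hj₁, hmin⟩ := s.exists_min_image f hs
    obtain ⟨j₂, hj₂, hne, hle⟩ := h j₁ hj₁
    exact ⟨j₁, hj₁, j₂, hj₂, hne.symm, fun k hk => ⟨hmin k hk, hle.trans (hmin k hk)⟩⟩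

/-- The tropical vector `y - x`, for `x` with finite coordinates. -/
noncomputable def tropSub (y : Fin n → WithTop ℝ) (x : Fin n → ℝ) (j : Fin n) : WithTop ℝ :=
  y j + ((-x j : ℝ) : WithTop ℝ)

theorem tropSub_ne_top_iff {y : Fin n → WithTop ℝ} : tropSub y x j ≠ ⊤ ↔ y j ≠ ⊤ := by
  simp [tropSub]

theorem notMem_relSupp :
    j ∉ relSupp x (Quotient.mk _ y) ↔ ∀ k, tropSub y.1 x j ≤ tropSub y.1 x k := by
  change ¬(∃ k, tropSub y.1 x k < tropSub y.1 x j) ↔ _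
  simp only [not_exists, not_lt]

theorem tropSub_ne_top_of_notMem_relSupp (hj : j ∉ relSupp x (Quotient.mk _ y)) :
    tropSub y.1 x j ≠ ⊤ := by
  obtain ⟨k, hk⟩ := y.2
  exact ne_top_of_le_ne_top (tropSub_ne_top_iff.2 hk) (notMem_relSupp.1 hj k)

variable {a : Fin d → Fin n → WithTop ℝ} {ρ : Fin d → Fin n} {B : Finset (Fin n)}

theorem tropicalMinor_image_le (a : Fin d → Fin n → WithTop ℝ) (ρ : Fin d → Fin n) :
    tropicalMinor a (Finset.univ.image ρ) ≤ ∑ i, a i (ρ i) :=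
  Finset.inf_le (f := fun j : Fin d → Fin n => ∑ i, a i (j i)) (by simp)

theorem exists_tropicalMinor_eq (a : Fin d → Fin n → WithTop ℝ) (hB : B.card = d) :
    ∃ ρ : Fin d → Fin n, Function.Injective ρ ∧ Finset.univ.image ρ = B ∧
      tropicalMinor a B = ∑ i, a i (ρ i) := by
  have hne : (Finset.univ.filter fun j : Fin d → Fin n => Finset.univ.image j = B).Nonempty :=
    ⟨B.orderEmbOfFin hB, by simp⟩
  obtain ⟨ρ, hρ, heq⟩ := Finset.exists_mem_eq_inf _ hne fun j : Fin d → Fin n => ∑ i, a i (j i)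
  have himage := (Finset.mem_filter.1 hρ).2
  refine ⟨ρ, Set.injOn_univ.1 ?_, himage, heq⟩
  rw [← Finset.coe_univ, ← Finset.card_image_iff, himage, hB, Finset.card_fin]

theorem sum_tropSub (a : Fin d → Fin n → WithTop ℝ) (x : Fin n → ℝ)
    (hρ : Function.Injective ρ) : ∑ i, tropSub (a i) x (ρ i) =
      ∑ i, a i (ρ i) + ((-∑ j ∈ Finset.univ.image ρ, x j : ℝ) : WithTop ℝ) := by
  simp only [tropSub, Finset.sum_add_distrib, Finset.sum_image hρ.injOn, ← Finset.sum_neg_distrib,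
    WithTop.coe_sum]

end TropicalVectors

namespace ValuatedMatroid

variable {n d : ℕ} {V : ValuatedMatroid n d} {x : Fin n → ℝ} {B C : Finset (Fin n)}
  {F : Set (Fin n)}

/-- The value of a base as a real number; the sets that are not bases get the value `0`. -/
noncomputable def valReal (V : ValuatedMatroid n d) (B : Finset (Fin n)) : ℝ := (V.val B).untop₀

theorem mem_baseFinsets_underlying : B ∈ baseFinsets V.underlying ↔ V.val B ≠ ⊤ := by
  rw [mem_baseFinsets]
  change (∃ B' : Finset (Fin n), (B' : Set (Fin n)) = B ∧ V.val B' ≠ ⊤) ↔ _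
  simp only [Finset.coe_inj, exists_eq_left]

theorem mem_baseFinsets_initial : B ∈ baseFinsets (V.initial x) ↔
    V.val B ≠ ⊤ ∧ ∀ B', V.height x B ≤ V.height x B' := by
  rw [mem_baseFinsets]
  change (∃ B' : Finset (Fin n), (B' : Set (Fin n)) = B ∧ V.val B' ≠ ⊤ ∧ _) ↔ _
  simp only [Finset.coe_inj, exists_eq_left]

theorem height_eq_coe (hB : V.val B ≠ ⊤) :
    V.height x B = ((V.valReal B - ∑ i ∈ B, x i : ℝ) : WithTop ℝ) := by
  rw [height, sub_eq_add_neg, WithTop.coe_add, valReal, WithTop.coe_untop₀_of_ne_top hB]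

theorem height_ne_top_iff : V.height x B ≠ ⊤ ↔ V.val B ≠ ⊤ := by simp [height]

theorem baseFinsets_initial (V : ValuatedMatroid n d) (x : Fin n → ℝ) :
    baseFinsets (V.initial x) = initialSets (baseFinsets V.underlying) V.valReal x := by
  ext B
  rw [mem_baseFinsets_initial, mem_initialSets, mem_baseFinsets_underlying]
  refine and_congr_right fun hB => forall_congr' fun B' => ?_
  rw [mem_baseFinsets_underlying]
  by_cases hB' : V.val B' = ⊤
  · simp [hB', height]
  · simp only [height_eq_coe hB, height_eq_coe hB', WithTop.coe_le_coe, ne_eq, hB',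
      not_false_eq_true, true_imp_iff]

theorem baseFinsets_initial_subset :
    baseFinsets (V.initial x) ⊆ baseFinsets V.underlying :=
  (baseFinsets_initial V x).trans_subset initialSets_subset

theorem card_of_mem_baseFinsets_underlying (hB : B ∈ baseFinsets V.underlying) : B.card = d :=
  V.card_of_ne_top (mem_baseFinsets_underlying.1 hB)

theorem card_of_mem_baseFinsets_initial (hB : B ∈ baseFinsets (V.initial x)) : B.card = d :=
  card_of_mem_baseFinsets_underlying (baseFinsets_initial_subset hB)

theorem eRank_underlying (V : ValuatedMatroid n d) : V.underlying.eRank = d := by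
  obtain ⟨B, hB⟩ := baseFinsets_nonempty V.underlying
  rw [← (mem_baseFinsets.1 hB).encard_eq_eRank, Set.encard_coe_eq_coe_finsetCard,
    card_of_mem_baseFinsets_underlying hB]

theorem eRank_initial (V : ValuatedMatroid n d) (x : Fin n → ℝ) : (V.initial x).eRank = d := by
  obtain ⟨B, hB⟩ := baseFinsets_nonempty (V.initial x)
  rw [← (mem_baseFinsets.1 hB).encard_eq_eRank, Set.encard_coe_eq_coe_finsetCard,
    card_of_mem_baseFinsets_initial hB]

instance : (V.initial x).Finite := ⟨Set.finite_univ⟩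

instance : V.underlying.Finite := ⟨Set.finite_univ⟩

theorem exists_pos_initial_add_smul_indicator (V : ValuatedMatroid n d) (x : Fin n → ℝ)
    (F : Set (Fin n)) : ∃ ε : ℝ, 0 < ε ∧
      V.initial (x + ε • F.indicator 1) = restrictSumContract (V.initial x) F := by
  have hF : F ⊆ (V.initial x).E := Set.subset_univ F
  obtain ⟨ε, hε, heq⟩ := exists_pos_initialSets_add_smul (baseFinsets V.underlying) V.valReal x
    (F.indicator 1)
  refine ⟨ε, hε, eq_of_baseFinsets_eq (restrictSumContract_ground hF).symm ?_⟩
  rw [baseFinsets_restrictSumContract hF, baseFinsets_initial, baseFinsets_initial, heq]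

theorem mk_mem_linearSpace_iff {y : TropVec n} : Quotient.mk _ y ∈ V.linearSpace ↔
    ∀ C : Finset (Fin n), C.card = d + 1 → ∀ e ∈ C, ∃ j ∈ C, j ≠ e ∧
      y.1 j + V.val (C.erase j) ≤ y.1 e + V.val (C.erase e) := by
  have hne : ∀ C : Finset (Fin n), C.card = d + 1 → C.Nonempty := fun C hC =>
    Finset.card_pos.1 (by omega)
  refine ⟨fun h C hC => (minAttainedTwice_iff.1 (h y rfl C hC)).2, fun h y' hy' C hC =>
    minAttainedTwice_iff.2 ⟨hne C hC, fun e he => ?_⟩⟩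
  obtain ⟨c, hc⟩ := Quotient.exact hy'
  obtain ⟨j, hj, hje, hle⟩ := h C hC e he
  refine ⟨j, hj, hje, ?_⟩
  simpa only [hc, add_right_comm _ (c : WithTop ℝ),
    WithTop.add_le_add_iff_right (WithTop.coe_ne_top (a := c))] using hle

theorem tropSub_add_height_erase (y : Fin n → WithTop ℝ) {j : Fin n} (hj : j ∈ C) :
    tropSub y x j + V.height x (C.erase j) =
      y j + V.val (C.erase j) + ((-∑ i ∈ C, x i : ℝ) : WithTop ℝ) := by
  rw [← Finset.add_sum_erase C x hj, neg_add, WithTop.coe_add, tropSub, height, add_add_add_comm]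

theorem exists_exchange_of_notMem_relSupp {y : TropVec n} (hy : Quotient.mk _ y ∈ V.linearSpace)
    (hB : B ∈ baseFinsets (V.initial x)) {e : Fin n} (he : e ∉ relSupp x (Quotient.mk _ y))
    (heB : e ∉ B) : ∃ j ∉ relSupp x (Quotient.mk _ y),
      j ≠ e ∧ (insert e B).erase j ∈ baseFinsets (V.initial x) := by
  obtain ⟨hBval, hBmin⟩ := mem_baseFinsets_initial.1 hB
  have hemin := notMem_relSupp.1 he
  have heC : e ∈ insert e B := Finset.mem_insert_self e B
  obtain ⟨j, hj, hje, hle⟩ := mk_mem_linearSpace_iff.1 hy (insert e B)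
    (by rw [Finset.card_insert_of_notMem heB, V.card_of_ne_top hBval]) e heC
  rw [← WithTop.add_le_add_iff_right WithTop.coe_ne_top, ← tropSub_add_height_erase (x := x) _ hj,
    ← tropSub_add_height_erase _ heC, Finset.erase_insert heB] at hle
  have he_top := tropSub_ne_top_of_notMem_relSupp he
  have hB'_top : V.height x ((insert e B).erase j) ≠ ⊤ :=
    (WithTop.add_ne_top.1 (ne_top_of_le_ne_top
      (WithTop.add_ne_top.2 ⟨he_top, height_ne_top_iff.2 hBval⟩) hle)).2
  have hB'le : V.height x ((insert e B).erase j) ≤ V.height x B :=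
    (WithTop.add_le_add_iff_left he_top).1 ((add_le_add_left (hemin j) _).trans hle)
  have hjle : tropSub y.1 x j ≤ tropSub y.1 x e :=
    (WithTop.add_le_add_iff_right hB'_top).1 (hle.trans (add_le_add_right (hBmin _) _))
  exact ⟨j, notMem_relSupp.2 fun k => hjle.trans (hemin k), hje, mem_baseFinsets_initial.2
    ⟨height_ne_top_iff.1 hB'_top, fun D => hB'le.trans (hBmin D)⟩⟩

theorem isFlat_relSupp {p : TropProj n} (hp : p ∈ V.linearSpace) (x : Fin n → ℝ) :
    (V.initial x).IsFlat (relSupp x p) := by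
  obtain ⟨y, rfl⟩ := Quotient.exists_rep p
  set F := relSupp x (Quotient.mk _ y)
  have hFE : F ⊆ (V.initial x).E := Set.subset_univ _
  refine (isFlat_iff_exists_isBase hFE).2 fun e he => ?_
  obtain ⟨S, hS, hSF⟩ := exists_isBase_inter_isBasis hFE
  by_cases heS : e ∈ S
  · exact ⟨S, hS, hSF, heS⟩
  obtain ⟨B, hB, rfl⟩ := exists_mem_baseFinsets_coe_eq hS
  obtain ⟨j, hjF, hje, hB'⟩ := exists_exchange_of_notMem_relSupp hp hB he.2 heS
  have hinter : (((insert e B).erase j : Finset (Fin n)) : Set (Fin n)) ∩ F =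
      (B : Set (Fin n)) ∩ F := by
    ext k
    have hk : k ∈ F → k ≠ j ∧ k ≠ e := fun hkF => ⟨fun h => hjF (h ▸ hkF), fun h => he.2 (h ▸ hkF)⟩
    simp only [Set.mem_inter_iff, Finset.mem_coe, Finset.mem_erase, Finset.mem_insert]
    tauto
  exact ⟨_, mem_baseFinsets.1 hB', hinter ▸ hSF,
    Finset.mem_erase.2 ⟨hje.symm, Finset.mem_insert_self e B⟩⟩

end ValuatedMatroid

/-! ### The rows of a presentation -/

theorem MatroidConnected.not_isColoop {α : Type*} {M : Matroid α} (hM : MatroidConnected M)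
    {e f : α} (he : e ∈ M.E) (hf : f ∈ M.E) (hef : e ≠ f) : ¬M.IsColoop e := by
  obtain ⟨C, hC, heC, -⟩ := hM.2 e he f hf hef
  exact hC.not_isColoop_of_mem heC

theorem not_isColoop_restrictSumContract {α : Type*} {M : Matroid α} {F : Set α} {e : α}
    (hF : IsCyclicFlat M F) (he : ¬M.IsColoop e) : ¬(restrictSumContract M F).IsColoop e := by
  have hFE := hF.1.subset_ground
  intro hcoloop
  have heE : e ∈ M.E := restrictSumContract_ground hFE ▸ hcoloop.mem_ground
  obtain ⟨B, hB, hBF, heB⟩ : ∃ B, M.IsBase B ∧ M.IsBasis (B ∩ F) F ∧ e ∉ B := by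
    by_cases heF : e ∈ F
    · obtain ⟨B, hB, hBF, hiff⟩ := (isCyclicFlat_iff_exists_isBase hFE).1 hF e heE
      exact ⟨B, hB, hBF, fun heB => hiff.1 heB heF⟩
    · exact exists_isBase_notMem_inter_isBasis hFE he heF
  exact heB (hcoloop.mem_of_isBase ((restrictSumContract_isBase_iff hFE).2 ⟨hB, hBF⟩))

section RelSupp

variable {n d : ℕ} {x : Fin n → ℝ} {F : Set (Fin n)} {p : TropProj n}

theorem exists_notMem_relSupp (x : Fin n → ℝ) (p : TropProj n) : ∃ k, k ∉ relSupp x p := by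
  obtain ⟨y, rfl⟩ := Quotient.exists_rep p
  have : Nonempty (Fin n) := ⟨y.2.choose⟩
  obtain ⟨k, hk⟩ := Finite.exists_min (tropSub y.1 x)
  exact ⟨k, notMem_relSupp.2 hk⟩

theorem tropSub_le_of_notMem_relSupp_add_smul_indicator {y : TropVec n} {t : ℝ} {j k : Fin n}
    (hjF : j ∈ F) (hkF : k ∉ F) (hk : k ∉ relSupp (x + t • F.indicator 1) (Quotient.mk _ y)) :
    tropSub y.1 x k ≤ tropSub y.1 x j + ((-t : ℝ) : WithTop ℝ) := by
  simpa [tropSub, hkF, hjF, add_assoc, add_comm] using notMem_relSupp.1 hk j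

theorem subset_relSupp_of_notMem_add_smul_indicator {ε : ℝ} (hε : 0 < ε) {k : Fin n} (hkF : k ∉ F)
    (hk : k ∉ relSupp (x + ε • F.indicator 1) p) : F ⊆ relSupp x p := by
  obtain ⟨y, rfl⟩ := Quotient.exists_rep p
  intro j hjF
  by_contra hj
  obtain ⟨r, hr⟩ := WithTop.ne_top_iff_exists.1 (tropSub_ne_top_of_notMem_relSupp hj)
  have hle := (notMem_relSupp.1 hj k).trans
    (tropSub_le_of_notMem_relSupp_add_smul_indicator hjF hkF hk)
  rw [← hr, ← WithTop.coe_add, WithTop.coe_le_coe] at hle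
  linarith

theorem encard_setOf_notMem {ι α : Type*} {σ : ι → α} (hσ : Function.Injective σ) (F : Set α) :
    {i | σ i ∉ F}.encard = (Set.range σ \ F).encard := by
  rw [← hσ.encard_image, Set.sdiff_eq, Set.inter_comm, ← Set.image_preimage_eq_inter_range]
  rfl

theorem countIn_mono (A : Fin d → TropProj n) {R R' : Set (TropProj n)} (h : R ⊆ R') :
    countIn A R ≤ countIn A R' :=
  Set.encard_le_encard fun _ hi => h hi

end RelSupp

namespace ValuatedMatroid

variable {n d : ℕ} {V : ValuatedMatroid n d} {a : Fin d → TropVec n} {c : ℝ} {x z : Fin n → ℝ}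
  {B : Finset (Fin n)} {F : Set (Fin n)} {σ : Fin d → Fin n}

theorem regionInfty_subset_regionZero (V : ValuatedMatroid n d) (x : Fin n → ℝ)
    (F : Set (Fin n)) : V.regionInfty F (V.initial x) ⊆ V.regionZero F x := by
  intro p hp
  obtain ⟨ε, hε, hcell⟩ := V.exists_pos_initial_add_smul_indicator x F
  obtain ⟨hpL, hpF⟩ := Set.mem_iInter₂.1 hp _ hcell
  obtain ⟨k, hk⟩ := exists_notMem_relSupp (x + ε • F.indicator 1) p
  exact ⟨hpL, subset_relSupp_of_notMem_add_smul_indicator hε (fun hkF => hk (hpF hkF)) hk⟩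

/-- The vector of the tropical maximal minors of the matrix with rows `a i` is `V + c`. -/
def PresentedBy (V : ValuatedMatroid n d) (a : Fin d → TropVec n) (c : ℝ) : Prop :=
  ∀ B : Finset (Fin n), B.card = d →
    tropicalMinor (fun i => (a i).1) B = V.val B + (c : WithTop ℝ)

theorem PresentedBy.val_add_le (hP : V.PresentedBy a c) (hσ : Function.Injective σ) :
    V.val (Finset.univ.image σ) + (c : WithTop ℝ) ≤ ∑ i, (a i).1 (σ i) := by
  have hcard : (Finset.univ.image σ).card = d := by
    rw [Finset.card_image_of_injective _ hσ, Finset.card_fin]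
  exact (hP _ hcard).symm.trans_le (tropicalMinor_image_le (fun i => (a i).1) σ)

theorem PresentedBy.exists_sum_eq (hP : V.PresentedBy a c) (hB : B.card = d) :
    ∃ σ : Fin d → Fin n, Function.Injective σ ∧ Finset.univ.image σ = B ∧
      ∑ i, (a i).1 (σ i) = V.val B + (c : WithTop ℝ) := by
  obtain ⟨σ, hσ, himage, hsum⟩ := exists_tropicalMinor_eq (fun i => (a i).1) hB
  exact ⟨σ, hσ, himage, hsum.symm.trans (hP B hB)⟩

theorem PresentedBy.mk_mem_linearSpace (hP : V.PresentedBy a c) (i : Fin d) :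
    Quotient.mk _ (a i) ∈ V.linearSpace := by
  refine mk_mem_linearSpace_iff.2 fun C hC e he => ?_
  obtain ⟨σ, hσ, himage, hsum⟩ := hP.exists_sum_eq (B := C.erase e)
    (by rw [Finset.card_erase_of_mem he, hC, Nat.add_sub_cancel])
  have hrange : ∀ k, σ k ∈ C.erase e := fun k =>
    himage ▸ Finset.mem_image_of_mem σ (Finset.mem_univ k)
  have he_range : e ∉ Set.range σ := by
    rintro ⟨k, rfl⟩
    exact Finset.notMem_erase _ _ (hrange k)
  have himage' := image_update_univ hσ he_range i
  rw [himage, Finset.insert_erase he] at himage'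
  have hσ' : Function.Injective (Function.update σ i e) :=
    injective_update_of_notMem_range hσ he_range i
  refine ⟨σ i, Finset.mem_of_mem_erase (hrange i), Finset.ne_of_mem_erase (hrange i), ?_⟩
  refine (WithTop.add_le_add_iff_right (WithTop.coe_ne_top (a := c))).1 ?_
  calc (a i).1 (σ i) + V.val (C.erase (σ i)) + c
      ≤ (a i).1 (σ i) + ∑ k, (a k).1 (Function.update σ i e k) := by
        rw [add_assoc, ← himage']
        exact add_le_add_right (hP.val_add_le hσ') _
    _ = (a i).1 e + ∑ k, (a k).1 (σ k) := add_sum_update (fun k => (a k).1) σ i e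
    _ = (a i).1 e + V.val (C.erase e) + c := by rw [hsum, add_assoc]

theorem PresentedBy.isOptimalAssignment (hP : V.PresentedBy a c) (hσ : Function.Injective σ)
    (hsum : ∑ i, (a i).1 (σ i) = V.val (Finset.univ.image σ) + (c : WithTop ℝ))
    (hz : Finset.univ.image σ ∈ baseFinsets (V.initial z)) :
    IsOptimalAssignment (fun i => tropSub (a i).1 z) σ := by
  refine ⟨hσ, fun ρ hρ => ?_⟩
  rw [sum_tropSub _ z hσ, sum_tropSub _ z hρ, hsum]
  refine le_trans ?_ (add_le_add_left (hP.val_add_le hρ) _)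
  rw [add_right_comm, add_right_comm _ (c : WithTop ℝ)]
  exact add_le_add_left ((mem_baseFinsets_initial.1 hz).2 _) _

theorem PresentedBy.notMem_relSupp (hP : V.PresentedBy a c) (hσ : Function.Injective σ)
    (hsum : ∑ i, (a i).1 (σ i) = V.val (Finset.univ.image σ) + (c : WithTop ℝ))
    (hB : Finset.univ.image σ ∈ baseFinsets (V.initial z))
    (hz : ∀ e f, e ≠ f → ¬(V.initial z).IsColoop e) (i : Fin d) :
    σ i ∉ relSupp z (Quotient.mk _ (a i)) := by
  refine _root_.notMem_relSupp.2 fun j => ?_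
  by_cases hj : j = σ i
  · rw [hj]
  obtain ⟨S, hS, hjS⟩ : ∃ S, (V.initial z).IsBase S ∧ j ∉ S := by
    simpa [isColoop_iff_forall_mem_isBase] using hz j (σ i) hj
  obtain ⟨B', hB', rfl⟩ := exists_mem_baseFinsets_coe_eq hS
  obtain ⟨τ, hτ, rfl, hτsum⟩ := hP.exists_sum_eq (card_of_mem_baseFinsets_initial hB')
  refine (hP.isOptimalAssignment hσ hsum hB).le_of_notMem_range
    (hP.isOptimalAssignment hτ hτsum hB') (WithTop.addLECancellable_of_ne_top ?_) ?_ i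
  · rw [sum_tropSub _ z hσ, hsum]
    exact WithTop.add_ne_top.2 ⟨WithTop.add_ne_top.2
      ⟨(mem_baseFinsets_initial.1 hB).1, WithTop.coe_ne_top⟩, WithTop.coe_ne_top⟩
  · simpa using hjS

theorem PresentedBy.exists_assignment (hP : V.PresentedBy a c) (x : Fin n → ℝ) (F : Set (Fin n)) :
    ∃ σ : Fin d → Fin n, Function.Injective σ ∧
      ∑ i, (a i).1 (σ i) = V.val (Finset.univ.image σ) + (c : WithTop ℝ) ∧
      Finset.univ.image σ ∈ baseFace (baseFinsets (V.initial x)) (F.indicator 1) ∧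
      matroidCorank (V.initial x) F = {i | σ i ∉ F}.encard := by
  obtain ⟨B, hB⟩ := baseFace_nonempty (baseFinsets_nonempty (V.initial x)) (F.indicator 1)
  obtain ⟨σ, hσ, rfl, hsum⟩ :=
    hP.exists_sum_eq (card_of_mem_baseFinsets_initial (baseFace_subset hB))
  obtain ⟨hbase, hbasis⟩ := (mem_baseFace_indicator_iff (Set.subset_univ F)).1 hB
  refine ⟨σ, hσ, hsum, hB, ?_⟩
  rw [matroidCorank_eq_encard_sdiff hbase hbasis, encard_setOf_notMem hσ, Finset.coe_image,
    Finset.coe_univ, Set.image_univ]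

theorem PresentedBy.countIn_regionZero_le (hP : V.PresentedBy a c)
    (hM : MatroidConnected (V.initial x)) (F : Set (Fin n)) :
    countIn (fun i => Quotient.mk _ (a i)) (V.regionZero F x) ≤ matroidCorank (V.initial x) F := by
  obtain ⟨σ, hσ, hsum, hB, hcorank⟩ := hP.exists_assignment x F
  rw [hcorank]
  refine Set.encard_le_encard fun i hi hiF => ?_
  exact hP.notMem_relSupp hσ hsum (baseFace_subset hB)
    (fun _ _ => hM.not_isColoop (Set.mem_univ _) (Set.mem_univ _)) i (hi.2 hiF)

theorem PresentedBy.matroidCorank_le_countIn_regionInfty (hP : V.PresentedBy a c)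
    (hM : MatroidConnected (V.initial x)) (hF : IsCyclicFlat (V.initial x) F) :
    matroidCorank (V.initial x) F ≤
      countIn (fun i => Quotient.mk _ (a i)) (V.regionInfty F (V.initial x)) := by
  obtain ⟨σ, hσ, hsum, hB, hcorank⟩ := hP.exists_assignment x F
  rw [← baseFinsets_restrictSumContract (Set.subset_univ F)] at hB
  have hrow : ∀ z, V.initial z = restrictSumContract (V.initial x) F → ∀ i,
      σ i ∉ relSupp z (Quotient.mk _ (a i)) := fun z hz =>
    hP.notMem_relSupp hσ hsum (hz ▸ hB) fun _ _ hef => hz ▸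
      not_isColoop_restrictSumContract hF (hM.not_isColoop (Set.mem_univ _) (Set.mem_univ _) hef)
  rw [hcorank]
  refine Set.encard_le_encard fun i hi => Set.mem_iInter₂.2 fun z hz =>
    ⟨hP.mk_mem_linearSpace i, ?_⟩
  obtain ⟨ε, hε, hcell⟩ := V.exists_pos_initial_add_smul_indicator z F
  have hcell' : V.initial (z + ε • F.indicator 1) = restrictSumContract (V.initial x) F := by
    rw [hcell, show V.initial z = _ from hz,
      restrictSumContract_restrictSumContract (Set.subset_univ F)]
  exact subset_relSupp_of_notMem_add_smul_indicator hε hi (hrow _ hcell' i)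

theorem PresentedBy.countIn_regionInfty_eq (hP : V.PresentedBy a c)
    (hM : MatroidConnected (V.initial x)) (hF : IsCyclicFlat (V.initial x) F) :
    countIn (fun i => Quotient.mk _ (a i)) (V.regionInfty F (V.initial x)) =
      matroidCorank (V.initial x) F :=
  ((countIn_mono _ (V.regionInfty_subset_regionZero x F)).trans
    (hP.countIn_regionZero_le hM F)).antisymm (hP.matroidCorank_le_countIn_regionInfty hM hF)

end ValuatedMatroid

/-! ### Points satisfying the counting conditions -/

theorem countIn_congr_of_map_eq {n d : ℕ} {A A' : Fin d → TropProj n}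
    (h : Finset.univ.val.map A = Finset.univ.val.map A') (R : Set (TropProj n)) :
    countIn A R = countIn A' R := by
  classical
  have hcount (A : Fin d → TropProj n) :
      countIn A R = (Multiset.countP (· ∈ R) (Finset.univ.val.map A) : ℕ∞) := by
    rw [countIn, Multiset.countP_map, ← Finset.filter_val, Finset.card_val,
      ← Set.encard_coe_eq_coe_finsetCard, Finset.coe_filter_univ]
  rw [hcount, hcount, h]

theorem exists_pos_not_subset_relSupp {n : ℕ} {y : TropVec n} {F : Set (Fin n)} {j : Fin n}
    (hj : j ∈ F) (hyj : y.1 j ≠ ⊤) (v : Fin n → ℝ) :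
    ∃ t : ℝ, 0 < t ∧ ¬F ⊆ relSupp (v + t • F.indicator 1) (Quotient.mk _ y) := by
  obtain ⟨k, hk⟩ := exists_notMem_relSupp v (Quotient.mk _ y)
  obtain ⟨s, hs⟩ := WithTop.ne_top_iff_exists.1 (tropSub_ne_top_of_notMem_relSupp hk)
  obtain ⟨r, hr⟩ := WithTop.ne_top_iff_exists.1 ((tropSub_ne_top_iff (x := v)).2 hyj)
  have hsr : s ≤ r := by
    have hkj := notMem_relSupp.1 hk j
    rwa [← hs, ← hr, WithTop.coe_le_coe] at hkj
  refine ⟨r - s + 1, by linarith, fun hF => ?_⟩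
  obtain ⟨m, hm⟩ := exists_notMem_relSupp (v + (r - s + 1) • F.indicator 1) (Quotient.mk _ y)
  have hle := (notMem_relSupp.1 hk m).trans
    (tropSub_le_of_notMem_relSupp_add_smul_indicator hj (fun hmF => hm (hF hmF)) hm)
  rw [← hs, ← hr, ← WithTop.coe_add, WithTop.coe_le_coe] at hle
  linarith

namespace ValuatedMatroid

variable {n d : ℕ} {V : ValuatedMatroid n d} {A : Fin d → TropProj n} {a : Fin d → TropVec n}
  {v x : Fin n → ℝ} {B : Finset (Fin n)} {F : Set (Fin n)}

/-- The point `v` of `ℝⁿ` represents the vertex `v_M` of a connected matroid `M` in `𝓜(V)`, namely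
of the initial matroid of `V` at `v`. -/
def IsVertex (V : ValuatedMatroid n d) (v : Fin n → ℝ) : Prop :=
  V.initial v ∈ V.initialMatroids ∧ MatroidConnected (V.initial v)

theorem exists_isVertex_superset (hV : MatroidConnected V.underlying) (x : Fin n → ℝ) :
    ∃ v, baseFinsets (V.initial x) ⊆ baseFinsets (V.initial v) ∧ V.IsVertex v := by
  obtain ⟨v, hxv, hv⟩ :=
    exists_initialSets_superset (baseFinsets_nonempty V.underlying) V.valReal x
  simp only [← baseFinsets_initial] at hxv hv
  refine ⟨v, hxv, ⟨⟨v, rfl⟩, fun e he => ?_⟩,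
    matroidConnected_iff_forall_isSeparator.2 ⟨hV.1, fun S hS => ?_⟩⟩
  · refine (isLoop_iff_forall_notMem_isBase (Set.mem_univ e)).2 fun T hT heT => ?_
    obtain ⟨B, hB, rfl⟩ := exists_mem_baseFinsets_coe_eq hT
    obtain ⟨B', hB', hiff⟩ := exists_mem_iff_of_sum_eq_imp hv hB e
    exact (isLoop_iff_forall_notMem_isBase (Set.mem_univ e)).1 he _ (mem_baseFinsets.1 hB')
      (hiff.2 heT)
  · obtain ⟨B₀, hB₀⟩ := baseFinsets_nonempty (V.initial v)
    have hconst := hv (S.indicator 1) ((B₀ : Set (Fin n)) ∩ S).ncard fun B hB => by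
      rw [sum_indicator_one, hS _ _ (mem_baseFinsets.1 hB) (mem_baseFinsets.1 hB₀)]
    refine (matroidConnected_iff_forall_isSeparator.1 hV).2 S fun T T' hT hT' => ?_
    obtain ⟨B, hB, rfl⟩ := exists_mem_baseFinsets_coe_eq hT
    obtain ⟨B', hB', rfl⟩ := exists_mem_baseFinsets_coe_eq hT'
    have heq := (hconst B hB).trans (hconst B' hB').symm
    rw [sum_indicator_one, sum_indicator_one] at heq
    exact_mod_cast heq

theorem exists_assignment_of_countIn_le (hA : ∀ i, A i ∈ V.linearSpace)
    (h : ∀ F, (V.initial v).IsFlat F →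
      countIn A (V.regionZero F v) ≤ matroidCorank (V.initial v) F)
    (hB : B ∈ baseFinsets (V.initial v)) : ∃ ρ : Fin d → Fin n,
      Function.Injective ρ ∧ Finset.univ.image ρ = B ∧ ∀ i, ρ i ∉ relSupp v (A i) := by
  classical
  let t (i : Fin d) : Finset (Fin n) := B.filter (· ∉ relSupp v (A i))
  have hall : ∀ I : Finset (Fin d), I.card ≤ (I.biUnion t).card := by
    intro I
    rcases I.eq_empty_or_nonempty with rfl | hI
    · simp
    have : Nonempty I := hI.to_subtype
    set F : Set (Fin n) := ⋂ i : I, relSupp v (A i) with hF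
    have hflat : (V.initial v).IsFlat F := IsFlat.iInter fun i => isFlat_relSupp (hA i) v
    have hsdiff : (B : Set (Fin n)) \ F = (I.biUnion t : Finset (Fin n)) := by
      ext j
      simp [hF, t]
    suffices (I.card : ℕ∞) ≤ (I.biUnion t).card by exact_mod_cast this
    calc (I.card : ℕ∞) = (I : Set (Fin d)).encard := (Set.encard_coe_eq_coe_finsetCard I).symm
      _ ≤ countIn A (V.regionZero F v) := Set.encard_le_encard fun i hi =>
          ⟨hA i, Set.iInter_subset (fun i : I => relSupp v (A i)) ⟨i, hi⟩⟩
      _ ≤ matroidCorank (V.initial v) F := h F hflat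
      _ ≤ ((B : Set (Fin n)) \ F).encard := matroidCorank_le_encard_sdiff (mem_baseFinsets.1 hB) F
      _ = (I.biUnion t).card := by rw [hsdiff, Set.encard_coe_eq_coe_finsetCard]
  obtain ⟨ρ, hρ, hρt⟩ := (Finset.all_card_le_biUnion_card_iff_exists_injective t).1 hall
  refine ⟨ρ, hρ, Finset.eq_of_subset_of_card_le (Finset.image_subset_iff.2 fun i _ =>
    (Finset.mem_filter.1 (hρt i)).1) ?_, fun i => (Finset.mem_filter.1 (hρt i)).2⟩
  rw [Finset.card_image_of_injective _ hρ, Finset.card_fin, card_of_mem_baseFinsets_initial hB]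

theorem tropicalMinor_image_add_eq_sum {k ρ : Fin d → Fin n}
    (hk : ∀ i, k i ∉ relSupp v (Quotient.mk _ (a i))) (hρ : Function.Injective ρ)
    (hρmin : ∀ i, ρ i ∉ relSupp v (Quotient.mk _ (a i))) :
    tropicalMinor (fun i => (a i).1) (Finset.univ.image ρ) +
      ((-∑ j ∈ Finset.univ.image ρ, v j : ℝ) : WithTop ℝ) = ∑ i, tropSub (a i).1 v (k i) := by
  apply le_antisymm
  · calc _ ≤ ∑ i, (a i).1 (ρ i) + ((-∑ j ∈ Finset.univ.image ρ, v j : ℝ) : WithTop ℝ) :=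
          add_le_add_left (tropicalMinor_image_le (fun i => (a i).1) ρ) _
      _ = ∑ i, tropSub (a i).1 v (ρ i) := (sum_tropSub (fun i => (a i).1) v hρ).symm
      _ ≤ _ := Finset.sum_le_sum fun i _ => notMem_relSupp.1 (hρmin i) _
  · obtain ⟨τ, hτ, himage, hminor⟩ := exists_tropicalMinor_eq (fun i => (a i).1)
      ((Finset.card_image_of_injective _ hρ).trans (Finset.card_fin d))
    rw [hminor, ← himage, ← sum_tropSub _ v hτ]
    exact Finset.sum_le_sum fun i _ => notMem_relSupp.1 (hk i) _

theorem exists_tropicalMinor_eq_add_of_countIn_le (hA : ∀ i, Quotient.mk _ (a i) ∈ V.linearSpace)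
    (h : ∀ F, (V.initial v).IsFlat F → countIn (fun i => Quotient.mk _ (a i)) (V.regionZero F v) ≤
      matroidCorank (V.initial v) F) :
    ∃ c : ℝ, ∀ B ∈ baseFinsets (V.initial v),
      tropicalMinor (fun i => (a i).1) B = V.val B + (c : WithTop ℝ) := by
  obtain ⟨B₀, hB₀⟩ := baseFinsets_nonempty (V.initial v)
  obtain ⟨k, -, -, hk⟩ := exists_assignment_of_countIn_le hA h hB₀
  obtain ⟨m, hm⟩ := WithTop.ne_top_iff_exists.1 (WithTop.sum_ne_top.2
    fun i _ => tropSub_ne_top_of_notMem_relSupp (hk i) : ∑ i, tropSub (a i).1 v (k i) ≠ ⊤)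
  obtain ⟨h₀, hh₀⟩ := WithTop.ne_top_iff_exists.1
    (height_ne_top_iff (x := v).2 (mem_baseFinsets_initial.1 hB₀).1)
  refine ⟨m - h₀, fun B hB => ?_⟩
  have hheight : V.height v B = h₀ := hh₀ ▸ le_antisymm
    ((mem_baseFinsets_initial.1 hB).2 B₀) ((mem_baseFinsets_initial.1 hB₀).2 B)
  obtain ⟨ρ, hρ, rfl, hρmin⟩ := exists_assignment_of_countIn_le hA h hB
  refine (WithTop.add_right_inj
    (WithTop.coe_ne_top (a := -∑ j ∈ Finset.univ.image ρ, v j))).1 ?_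
  rw [tropicalMinor_image_add_eq_sum hk hρ hρmin, add_right_comm,
    show V.val _ + _ = (h₀ : WithTop ℝ) from hheight, ← hm, ← WithTop.coe_add, add_sub_cancel]

theorem exists_initial_of_exchange {e f : Fin n} (hB : B ∈ baseFinsets V.underlying) (he : e ∈ B)
    (hf : f ∉ B) (hB' : insert f (B.erase e) ∈ baseFinsets V.underlying) :
    ∃ x, B ∈ baseFinsets (V.initial x) ∧
      insert f (B.erase e) ∈ baseFinsets (V.initial x) := by
  set B' := insert f (B.erase e) with hB'_def
  have hef : e ≠ f := fun h => hf (h ▸ he)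
  let x₀ : Fin n → ℝ := Pi.single e (V.valReal B - V.valReal B')
  have hx₀ : V.valReal B - ∑ i ∈ B, x₀ i = V.valReal B' - ∑ i ∈ B', x₀ i := by
    have heB' : e ∉ B' := by simp [hB'_def, hef]
    simp only [x₀, Finset.sum_pi_single', if_pos he, if_neg heB']
    ring
  let g : Fin n → ℝ := fun i =>
    (if i ∈ B.erase e then 1 else 0) - if i ∈ insert f B then 0 else 1
  have hface (C : Finset (Fin n)) : C ∈ baseFace (baseFinsets V.underlying) g ↔
      C ∈ baseFinsets V.underlying ∧ B.erase e ⊆ C ∧ C ⊆ insert f B :=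
    mem_baseFace_interval hB (B.erase_subset e) (Finset.subset_insert f B)
  have hmem : ∀ C ∈ baseFace (baseFinsets V.underlying) g, C = B ∨ C = B' := by
    intro C hC
    obtain ⟨hCV, hBC, hCB⟩ := (hface C).1 hC
    have hcard {D : Finset (Fin n)} (hD : D ∈ baseFinsets V.underlying) : D.card = d :=
      card_of_mem_baseFinsets_underlying hD
    by_cases hfC : f ∈ C
    · exact Or.inr (Finset.eq_of_subset_of_card_le (Finset.insert_subset hfC hBC)
        ((hcard hCV).trans (hcard hB').symm).le).symm
    · exact Or.inl (Finset.eq_of_subset_of_card_le ((Finset.subset_insert_iff_of_notMem hfC).1 hCB)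
        ((hcard hB).trans (hcard hCV).symm).le)
  obtain ⟨t, ht⟩ := exists_initialSets_add_smul_eq (baseFinsets V.underlying) V.valReal x₀ g
  refine ⟨x₀ + t • g, ?_, ?_⟩ <;> rw [baseFinsets_initial, ht, mem_initialSets, hface]
  · refine ⟨⟨hB, B.erase_subset e, Finset.subset_insert f B⟩, fun C hC => ?_⟩
    rcases hmem C hC with rfl | rfl
    exacts [le_rfl, hx₀.le]
  · refine ⟨⟨hB', Finset.subset_insert _ _, Finset.insert_subset_insert f (B.erase_subset e)⟩,
      fun C hC => ?_⟩
    rcases hmem C hC with rfl | rfl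
    exacts [hx₀.ge, le_rfl]

theorem exists_eq_val_add_of_forall_isVertex (hV : MatroidConnected V.underlying)
    {w : Finset (Fin n) → WithTop ℝ} (h : ∀ v, V.IsVertex v → ∃ c : ℝ,
      ∀ B ∈ baseFinsets (V.initial v), w B = V.val B + (c : WithTop ℝ)) :
    ∃ c : ℝ, ∀ B ∈ baseFinsets V.underlying, w B = V.val B + (c : WithTop ℝ) := by
  obtain ⟨v₀, -, hv₀⟩ := exists_isVertex_superset hV 0
  obtain ⟨B₀, hB₀⟩ := baseFinsets_nonempty (V.initial v₀)
  obtain ⟨c, hc⟩ := h v₀ hv₀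
  have hB₀V : V.underlying.IsBase (B₀ : Set (Fin n)) :=
    mem_baseFinsets.1 (baseFinsets_initial_subset hB₀)
  refine ⟨c, fun B hB => ?_⟩
  let φ (S : Set (Fin n)) : Prop := ∀ D : Finset (Fin n), (D : Set (Fin n)) = S →
    w D = V.val D + (c : WithTop ℝ)
  have hφ {D : Finset (Fin n)} {c' : ℝ} (hD : D ∈ baseFinsets V.underlying)
      (hc' : w D = V.val D + (c' : WithTop ℝ)) : φ D ↔ c' = c := by
    simp only [φ, Finset.coe_inj, forall_eq, hc',
      WithTop.add_left_inj (mem_baseFinsets_underlying.1 hD), WithTop.coe_eq_coe]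
  have hexchange : φ B = φ B₀ := by
    refine isBase_induction_exchange φ (fun S e f hS he hf hS' => ?_) (mem_baseFinsets.1 hB) hB₀V
    obtain ⟨D, hD, rfl⟩ := exists_mem_baseFinsets_coe_eq hS
    rw [← Finset.coe_erase, ← Finset.coe_insert] at hS' ⊢
    have hD' := mem_baseFinsets.2 hS'
    obtain ⟨x, hDx, hDx'⟩ := exists_initial_of_exchange hD he hf hD'
    obtain ⟨v, hxv, hv⟩ := exists_isVertex_superset hV x
    obtain ⟨c', hc'⟩ := h v hv
    exact propext ((hφ hD (hc' D (hxv hDx))).trans (hφ hD' (hc' _ (hxv hDx'))).symm)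
  exact hexchange.mpr ((hφ (mem_baseFinsets.2 hB₀V) (hc B₀ hB₀)).2 rfl) B rfl

theorem exists_isVertex_isCyclicFlat (hV : MatroidConnected V.underlying)
    (hF : IsCyclicFlat V.underlying F) :
    ∃ v, V.IsVertex v ∧ IsCyclicFlat (V.initial v) F ∧ ∃ B ∈ baseFinsets (V.initial v),
      B ∈ baseFace (baseFinsets V.underlying) (F.indicator 1) := by
  have hFV : F ⊆ V.underlying.E := Set.subset_univ F
  set 𝓕 := baseFace (baseFinsets V.underlying) (F.indicator 1) with h𝓕
  have h𝓕ne : 𝓕.Nonempty := baseFace_nonempty (baseFinsets_nonempty _) _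
  -- Going far enough in direction `F` makes the initial bases maximize the intersection with `F`.
  obtain ⟨x, -, hx⟩ := exists_initialSets_superset h𝓕ne V.valReal 0
  obtain ⟨t, ht⟩ :=
    exists_initialSets_add_smul_eq (baseFinsets V.underlying) V.valReal x (F.indicator 1)
  obtain ⟨v, hxv, hv⟩ := exists_isVertex_superset hV (x + t • F.indicator 1)
  rw [baseFinsets_initial, ht, ← h𝓕] at hxv
  refine ⟨v, hv, (isCyclicFlat_iff_exists_isBase (Set.subset_univ F)).2 fun e he => ?_, ?_⟩
  · obtain ⟨S, hS, hSF, heS⟩ := (isCyclicFlat_iff_exists_isBase hFV).1 hF e he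
    obtain ⟨B, -, rfl⟩ := exists_mem_baseFinsets_coe_eq hS
    obtain ⟨B', hB', hiff⟩ :=
      exists_mem_iff_of_sum_eq_imp hx ((mem_baseFace_indicator_iff hFV).2 ⟨hS, hSF⟩) e
    obtain ⟨hB'base, hB'F⟩ := (mem_baseFace_indicator_iff (Set.subset_univ F)).1
      (mem_baseFace_of_subset baseFinsets_initial_subset (hxv hB') (initialSets_subset hB'))
    exact ⟨B', hB'base, hB'F, hiff.trans heS⟩
  · obtain ⟨B, hB⟩ := initialSets_nonempty h𝓕ne V.valReal x
    exact ⟨B, hxv hB, initialSets_subset hB⟩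

theorem matroidCorank_initial_eq (hB : B ∈ baseFinsets (V.initial v))
    (hBF : B ∈ baseFace (baseFinsets V.underlying) (F.indicator 1)) :
    matroidCorank (V.initial v) F = matroidCorank V.underlying F := by
  have hBFv := mem_baseFace_of_subset baseFinsets_initial_subset hB hBF
  obtain ⟨hbase, hbasis⟩ := (mem_baseFace_indicator_iff (Set.subset_univ F)).1 hBF
  obtain ⟨hbase', hbasis'⟩ := (mem_baseFace_indicator_iff (Set.subset_univ F)).1 hBFv
  rw [matroidCorank_eq_encard_sdiff hbase hbasis, matroidCorank_eq_encard_sdiff hbase' hbasis']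

theorem initial_add_smul_indicator {t : ℝ} (ht : 0 < t) (hB : B ∈ baseFinsets (V.initial v))
    (hBF : B ∈ baseFace (baseFinsets V.underlying) (F.indicator 1)) :
    V.initial (v + t • F.indicator 1) = restrictSumContract (V.initial v) F := by
  have hF : F ⊆ (V.initial v).E := Set.subset_univ F
  refine eq_of_baseFinsets_eq (restrictSumContract_ground hF).symm ?_
  rw [baseFinsets_initial] at hB
  rw [baseFinsets_restrictSumContract hF, baseFinsets_initial, baseFinsets_initial,
    initialSets_add_smul_of_mem ht hB hBF]

theorem matroidCorank_le_encard_setOf_eq_top (hV : MatroidConnected V.underlying)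
    (h : ∀ v, V.IsVertex v → ∀ F, IsCyclicFlat (V.initial v) F →
      countIn (fun i => Quotient.mk _ (a i)) (V.regionInfty F (V.initial v)) =
        matroidCorank (V.initial v) F) (hF : IsCyclicFlat V.underlying F) :
    matroidCorank V.underlying F ≤ {i | ∀ j ∈ F, (a i).1 j = ⊤}.encard := by
  obtain ⟨v, hv, hFv, B, hB, hBF⟩ := exists_isVertex_isCyclicFlat hV hF
  rw [← matroidCorank_initial_eq hB hBF, ← h v hv F hFv]
  refine Set.encard_le_encard fun i hi j hj => ?_
  by_contra hij
  obtain ⟨t, ht, hFt⟩ := exists_pos_not_subset_relSupp hj hij v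
  exact hFt (Set.mem_iInter₂.1 hi _ (initial_add_smul_indicator ht hB hBF)).2

theorem tropicalMinor_eq_top_of_countIn (hV : MatroidConnected V.underlying)
    (h : ∀ v, V.IsVertex v → ∀ F, IsCyclicFlat (V.initial v) F →
      countIn (fun i => Quotient.mk _ (a i)) (V.regionInfty F (V.initial v)) =
        matroidCorank (V.initial v) F) (hB : B.card = d) (hBV : V.val B = ⊤) :
    tropicalMinor (fun i => (a i).1) B = ⊤ := by
  obtain ⟨τ, hτ, rfl, hminor⟩ := exists_tropicalMinor_eq (fun i => (a i).1) hB
  by_contra hne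
  rw [hminor, ← ne_eq, WithTop.sum_ne_top] at hne
  have hnb : ¬V.underlying.IsBase (Finset.univ.image τ : Finset (Fin n)) := fun hbase =>
    mem_baseFinsets_underlying.1 (mem_baseFinsets.2 hbase) hBV
  obtain ⟨F, hF, hlt⟩ := exists_isCyclicFlat_encard_sdiff_lt (Set.subset_univ _)
    (by rw [Set.encard_coe_eq_coe_finsetCard, hB, eRank_underlying]) hnb
  refine hlt.not_ge ((matroidCorank_le_encard_setOf_eq_top hV h hF).trans ?_)
  rw [Finset.coe_image, Finset.coe_univ, Set.image_univ, ← encard_setOf_notMem hτ]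
  exact Set.encard_le_encard fun i hi hiF => hne i (Finset.mem_univ i) (hi _ hiF)

theorem mem_linearSpace_of_countIn_regionInfty (h : ∀ F, IsCyclicFlat (V.initial v) F →
    countIn A (V.regionInfty F (V.initial v)) = matroidCorank (V.initial v) F) (i : Fin d) :
    A i ∈ V.linearSpace := by
  -- The loops form a cyclic flat of corank `d`, so all `d` points lie in its region at infinity.
  have hcount := h _ (isCyclicFlat_closure (Set.empty_subset _) fun e he => he.elim)
  rw [matroidCorank, eRk_closure_eq, eRk_empty, tsub_zero, eRank_initial] at hcount
  have huniv : {i | A i ∈ V.regionInfty ((V.initial v).closure ∅) (V.initial v)} = Set.univ :=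
    Set.toFinite _ |>.eq_of_subset_of_encard_le (Set.subset_univ _) (by
      rw [Set.encard_univ, ENat.card_eq_coe_fintype_card, Fintype.card_fin]
      exact hcount.ge)
  exact (V.regionInfty_subset_regionZero v _ (huniv.symm.subset (Set.mem_univ i))).1

theorem exists_presentedBy (hV : MatroidConnected V.underlying)
    (h : ∀ v, V.IsVertex v →
      (∀ F, (V.initial v).IsFlat F → countIn (fun i => Quotient.mk _ (a i)) (V.regionZero F v) ≤
        matroidCorank (V.initial v) F) ∧
      (∀ F, IsCyclicFlat (V.initial v) F →
        countIn (fun i => Quotient.mk _ (a i)) (V.regionInfty F (V.initial v)) =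
          matroidCorank (V.initial v) F)) :
    ∃ c, V.PresentedBy a c := by
  obtain ⟨c, hc⟩ := exists_eq_val_add_of_forall_isVertex hV fun v hv =>
    exists_tropicalMinor_eq_add_of_countIn_le
      (mem_linearSpace_of_countIn_regionInfty (h v hv).2) (h v hv).1
  refine ⟨c, fun B hB => ?_⟩
  by_cases hBV : V.val B = ⊤
  · rw [tropicalMinor_eq_top_of_countIn hV (fun v hv => (h v hv).2) hB hBV, hBV, top_add]
  · exact hc B (mem_baseFinsets_underlying.2 hBV)

end ValuatedMatroid

theorem theorem4p11_general {n d : ℕ} (V : ValuatedMatroid n d)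
    (hV : MatroidConnected V.underlying) (A : Fin d → TropProj n) :
    V.IsPresentation (Finset.univ.val.map A) ↔
      ∀ M ∈ V.initialMatroids, MatroidConnected M → ∀ v ∈ V.relintCell M,
        (∀ F, M.IsFlat F → countIn A (V.regionZero F v) ≤ matroidCorank M F) ∧
        (∀ F, IsCyclicFlat M F → countIn A (V.regionInfty F M) = matroidCorank M F) := by
  constructor
  · rintro ⟨a, hA, c, hP : V.PresentedBy a c⟩ M - hM v rfl
    simp only [countIn_congr_of_map_eq hA]
    exact ⟨fun F _ => hP.countIn_regionZero_le hM F, fun F hF => hP.countIn_regionInfty_eq hM hF⟩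
  · intro h
    obtain ⟨a, rfl⟩ : ∃ a : Fin d → TropVec n, A = fun i => Quotient.mk _ (a i) :=
      ⟨fun i => (A i).out, funext fun i => (Quotient.out_eq (A i)).symm⟩
    obtain ⟨c, hP⟩ := ValuatedMatroid.exists_presentedBy hV fun v hv => h _ hv.1 hv.2 v rfl
    exact ⟨a, rfl, c, hP⟩

theorem theorem4p11 {n d : ℕ} (V : ValuatedMatroid n d)
    (hV : MatroidConnected V.underlying)
    (A : Fin d → TropProj n) (hA : ∀ i, A i ∈ V.linearSpace) :
    V.IsPresentation (Finset.univ.val.map A) ↔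
      ∀ M ∈ V.initialMatroids, MatroidConnected M → ∀ v ∈ V.relintCell M,
        (∀ F, M.IsFlat F → countIn A (V.regionZero F v) ≤ matroidCorank M F) ∧
        (∀ F, IsCyclicFlat M F → countIn A (V.regionInfty F M) = matroidCorank M F) :=
  theorem4p11_general V hV A
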